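/- For a group $G$ and a subgroup $H\leqslant G$ let $H^{(1)}_{\mathbb Q}=\{h\in H \mid h^k\in[H,H]\text{ for some integer }k\neq 0\}$, which is the kernel of the natural map $H\to H_1(H;\mathbb Q)$. The rational derived series of $G$ is defined by $G^{(0)}_{\mathbb Q}=G$ and $G^{(i+1)}_{\mathbb Q}=\bigl(G^{(i)}_{\mathbb Q}\bigr)^{(1)}_{\mathbb Q}$; put $G^{(\omega)}_{\mathbb Q}=\bigcap_{i\geqslant 0}G^{(i)}_{\mathbb Q}$ and $G^{(\omega+1)}_{\mathbb Q}=\bigl(G^{(\omega)}_{\mathbb Q}\bigr)^{(1)}_{\mathbb Q}$. A group $G$ is residually $\mathbb Q$-solvable if $G^{(\omega)}_{\mathbb Q}=1$, and rationally perfect if $G^{(1)}_{\mathbb Q}=G$. Write $\langle\langle x\rangle\rangle$ for the normal closure of an element $x$ of $F$, and $\langle\langle x\rangle\rangle_G$ for the normal closure in $G$ of the image of $x$. Theorem 1.1. Let $F$ be a free group with a fixed free basis (of any cardinality), let $|x|$ be the reduced word length of $x\in F$ with respect to this basis, let $w\in F$ and let $G=F/\langle\langle w\rangle\rangle$. There are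 an element $r\in F$ with $|r|\leqslant|w|$ and an integer $k\geqslant 1$ such that $w\in r^k\,[\langle\langle r\rangle\rangle,\langle\langle r\rangle\rangle]$ and $$G^{(\omega+1)}_{\mathbb Q}=G^{(\omega)}_{\mathbb Q}=\langle\langle r\rangle\rangle_G .$$ In particular, the group $G^{(\omega)}_{\mathbb Q}$ is rationally perfect and is the normal closure in $G$ of a single element, and $F/\langle\langle r\rangle\rangle$ is the maximal residually $\mathbb Q$-solvable quotient of $G$: the identity of $F$ induces an epimorphism $\pi\colon G\to F/\langle\langle r\rangle\rangle$, the group $F/\langle\langle r\rangle\rangle$ is residually $\mathbb Q$-solvable, and for every normal subgroup $N$ of $G$ with $G/N$ residually $\mathbb Q$-solvable the projection $G\to G/N$ factors through $\pi$. -/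

import Mathlib

namespace RationalDerived

/-- If `a`, `b` have nontrivial powers in `⁅H, H⁆`, so has their product. -/
theorem exists_zpow_mul_mem {G : Type*} [Group G] {H : Subgroup G} {a b : G}
    (ha : a ∈ H) (hb : b ∈ H)
    (hak : ∃ k : ℤ, k ≠ 0 ∧ a ^ k ∈ ⁅H, H⁆) (hbk : ∃ k : ℤ, k ≠ 0 ∧ b ^ k ∈ ⁅H, H⁆) :
    ∃ k : ℤ, k ≠ 0 ∧ (a * b) ^ k ∈ ⁅H, H⁆ := by
  have key : ∀ x : H, (x : G) ∈ ⁅H, H⁆ ↔ Abelianization.of x = 1 := by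
    intro x
    rw [← MonoidHom.mem_ker, Abelianization.ker_of, ← Subgroup.map_subtype_commutator,
      Subgroup.mem_map]
    constructor
    · rintro ⟨y, hy, hyx⟩
      have : y = x := Subtype.ext hyx
      exact this ▸ hy
    · intro hx
      exact ⟨x, hx, rfl⟩
  obtain ⟨k, hk, hak⟩ := hak
  obtain ⟨l, hl, hbl⟩ := hbk
  refine ⟨k * l, mul_ne_zero hk hl, ?_⟩
  have h1 := (key ((⟨a, ha⟩ : H) ^ k)).1 (by simpa using hak)
  have h2 := (key ((⟨b, hb⟩ : H) ^ l)).1 (by simpa using hbl)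
  have h3 := (key (((⟨a, ha⟩ : H) * ⟨b, hb⟩) ^ (k * l))).2 (by
    rw [map_zpow] at h1 h2
    rw [map_zpow, map_mul, mul_zpow, zpow_mul, h1, one_zpow, mul_comm k l, zpow_mul, h2,
      one_zpow, one_mul])
  simpa using h3

/-- The rational derived subgroup of a subgroup `H` of `G`: the elements of `H` with a power
(of nonzero exponent) in `⁅H, H⁆`, i.e. the kernel of the natural map `H → H₁(H; ℚ)`. -/
def rationalDerivedSubgroup {G : Type*} [Group G] (H : Subgroup G) : Subgroup G where
  carrier := {g | g ∈ H ∧ ∃ k : ℤ, k ≠ 0 ∧ g ^ k ∈ ⁅H, H⁆}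
  one_mem' := ⟨H.one_mem, 1, one_ne_zero, by simp⟩
  mul_mem' := fun ha hb => ⟨H.mul_mem ha.1 hb.1, exists_zpow_mul_mem ha.1 hb.1 ha.2 hb.2⟩
  inv_mem' := by
    rintro x ⟨hx, k, hk, hxk⟩
    exact ⟨H.inv_mem hx, k, hk, by rw [inv_zpow]; exact Subgroup.inv_mem _ hxk⟩

/-- The rational derived series: its term of index `0` is `G`, and each further term is the
rational derived subgroup of the previous one. -/
def rationalDerivedSeries (G : Type*) [Group G] : ℕ → Subgroup G
  | 0 => ⊤
  | n + 1 => rationalDerivedSubgroup (rationalDerivedSeries G n)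

/-- The term of index `ω`: the intersection of all terms of finite index. -/
def rationalDerivedOmega (G : Type*) [Group G] : Subgroup G :=
  ⨅ n : ℕ, rationalDerivedSeries G n

/-- The term of index `ω + 1`. -/
def rationalDerivedOmegaSucc (G : Type*) [Group G] : Subgroup G :=
  rationalDerivedSubgroup (rationalDerivedOmega G)

/-- A group is rationally perfect if it equals its own rational derived subgroup
(its abelianisation is torsion). -/
def IsRationallyPerfect (G : Type*) [Group G] : Prop :=
  rationalDerivedSubgroup (⊤ : Subgroup G) = ⊤

/-- A group is residually rationally solvable if its rational derived series has trivial
intersection. -/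
def IsResiduallyRationallySolvable (G : Type*) [Group G] : Prop :=
  rationalDerivedOmega G = ⊥

/-- `π : G → Q` is the maximal residually rationally solvable quotient of `G`: it is onto, `Q` is
residually rationally solvable, and every residually rationally solvable quotient of `G` is a
quotient of `Q` through `π`. -/
def IsMaximalResiduallyRationallySolvableQuotient {G Q : Type*} [Group G] [Group Q]
    (π : G →* Q) : Prop :=
  Function.Surjective π ∧ IsResiduallyRationallySolvable Q ∧
    ∀ (N : Subgroup G) [N.Normal], IsResiduallyRationallySolvable (G ⧸ N) →
      ∃ φ : Q →* G ⧸ N, φ.comp π = QuotientGroup.mk' N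

/-- The one-relator group `F(α) / ⟨⟨w⟩⟩`. -/
abbrev OneRelatorGroup {α : Type*} (w : FreeGroup α) : Type _ :=
  FreeGroup α ⧸ Subgroup.normalClosure ({w} : Set (FreeGroup α))

/-- The natural projection `F(α) → F(α) / ⟨⟨w⟩⟩`. -/
abbrev OneRelatorGroup.proj {α : Type*} (w : FreeGroup α) : FreeGroup α →* OneRelatorGroup w :=
  QuotientGroup.mk' (Subgroup.normalClosure ({w} : Set (FreeGroup α)))

end RationalDerived

/-!
# The maximal residually rationally solvable quotient of a one-relator group

Let `K n` be the preimage in the free group `F` of the `n`-th term of the rational derived series of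
`F ⧸ ⟨⟨w⟩⟩` (`quotientSeries`), let `N` be the intersection of all `K n` (`quotientOmega`), and let
`Γ` be one of the quotients of `F` by these subgroups. An element of `F` is read as a path in the
Cayley graph of `Γ`; a closed path has a class in the rational `1`-chains `Γ × α →₀ ℚ` of this graph
(`cls`, `path`), on which the group ring of `Γ` acts (`conv`). Closed paths with equal classes agree
modulo commutators of the kernel (`mem_commutator_of_cls_path_eq_zero`).

*The relator `r`.* If the class of `w` over `F ⧸ N` vanishes, then `w ∈ ⁅N, N⁆` and `r = 1`.
Otherwise the class of `w` is a flow without sources and sinks, and some edge-simple circuit follows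
it in the positive direction. The path `w` travels to the circuit, runs along all its edges and comes
back, so that a suitable conjugate `r` of the circuit is not longer than `w` (`exists_circuit`). The
element `r` lies in `N`, hence over each `F ⧸ K n` some nonzero multiple of its class has the form
`p • [w]` with `p` in the group ring. For large `n` the finite supports of `[r]` and `[w]` are the
same over `F ⧸ K n` as over `F ⧸ N`; thus `p • [w]` is supported on the support of `[w]`. Since
`F ⧸ K n` is locally indicable (`locallyIndicable_quotientSeries`), this forces `p` to be a scalar
(`support_subset_one_of_conv`). So `[w]` and `[r]` are proportional (`exists_smul_cls_path_eq`), and as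
the coefficients of `[r]` are `0` or `±1`, in fact `[w] = k • [r]` with an integer `k ≥ 1`, that is,
`w ∈ r ^ k ⁅N, N⁆`. It follows that `w` and `r` define the same subgroups `K n`
(`quotientSeries_congr`), and it remains to prove that `N` is not larger than `⟨⟨r⟩⟩`.

*Simple relators.* Suppose that `c` lifts to an edge-simple closed path over some `Γ = F ⧸ K n`, where
the subgroups `K n` are now those of `c`. Then `⟨⟨c⟩⟩` is the intersection of the `K n`
(`iInf_quotientSeries_le`). To separate `x ∉ ⟨⟨c⟩⟩` from this intersection, it suffices to find a
unipotent rational representation of the free group on the edges of the Cayley graph that kills all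
lifts of `c`, but not the path of `x`: a representation of this kind maps `K (n + j)` to the `j + 1`-st
term of the filtration of the unipotent matrices by their distance to the identity
(`lift_path_mem_units`). Any finite set of edges lies in a finite set `Z` which is saturated for the
class `m` of `c`: the chains in the module generated by `m` that are supported on `Z` are combinations
of the translates of `m` supported on `Z` (`exists_saturated`). The finitely many translates of `c`
inside `Z` can be collapsed: by unique products, they can be ordered such that each has an edge that
does not occur later, which is then eliminated (`exists_collapse`). The resulting group is free and
hence residually unipotent (`exists_unipotent_ne_one`), which gives the representation on `Z`. It is
extended to all edges one filtration degree after the other (`exists_extension`). Each step prescribes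
a linear functional on the translates of `m` that vanishes on the edges in `Z`, and by saturation the
translates not supported on `Z` are linearly independent modulo the chains on `Z`
(`Saturated.exists_linearMap`).

Both saturation and the statement on scalars are proved by induction on the size of the support. Local
indicability provides a degree on the translates of the support of `m` that is additive and not
constant on this support (`exists_degree`), and the top-degree part of `m` has smaller support.
-/

namespace OneRelator

open RationalDerived

/-! ### Locally indicable groups -/

/-- A group is locally indicable if each of its nontrivial finitely generated subgroups has a
nontrivial homomorphism to `ℤ`. -/
def LocallyIndicable (Γ : Type*) [Group Γ] : Prop :=
  ∀ H : Subgroup Γ, H.FG → H ≠ ⊥ → ∃ φ : H →* Multiplicative ℤ, φ ≠ 1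

theorem exists_hom_int_of_fg_of_torsionFree {A : Type*} [CommGroup A] [Group.FG A] [Nontrivial A]
    (htf : ∀ x : A, ∀ k : ℤ, k ≠ 0 → x ^ k = 1 → x = 1) :
    ∃ φ : A →* Multiplicative ℤ, φ ≠ 1 := by
  have : Module.Finite ℤ (Additive A) := Module.Finite.iff_addGroup_fg.2 inferInstance
  have : Module.IsTorsionFree ℤ (Additive A) := by
    refine Module.IsTorsionFree.of_smul_eq_zero fun k x hkx => ?_
    by_contra! hne
    exact hne.2 (htf x.toMul k hne.1 hkx)
  have : Module.Free ℤ (Additive A) := inferInstance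
  let b := Module.Free.chooseBasis ℤ (Additive A)
  obtain ⟨x, hx⟩ := exists_ne (0 : Additive A)
  obtain ⟨i, hi⟩ : ∃ i, b.repr x i ≠ 0 := by
    by_contra! hall
    exact hx (b.repr.map_eq_zero_iff.1 (Finsupp.ext hall))
  refine ⟨AddMonoidHom.toMultiplicativeRight (b.coord i).toAddMonoidHom, fun h => hi ?_⟩
  exact DFunLike.congr_fun h x.toMul

/-- An extension of a locally indicable group by a torsion-free abelian group is locally
indicable. -/
theorem LocallyIndicable.of_hom {Γ' Γ : Type*} [Group Γ'] [Group Γ] (f : Γ' →* Γ)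
    (h : LocallyIndicable Γ) (hcomm : ∀ x ∈ f.ker, ∀ y ∈ f.ker, x * y = y * x)
    (htf : ∀ x ∈ f.ker, ∀ k : ℤ, k ≠ 0 → x ^ k = 1 → x = 1) : LocallyIndicable Γ' := by
  intro H hfg hne
  by_cases hH : H.map f = ⊥
  · have hle : H ≤ f.ker := (Subgroup.map_eq_bot_iff H).1 hH
    let _ : CommGroup H :=
      { (inferInstance : Group H) with
        mul_comm := fun x y => Subtype.ext (hcomm x (hle x.2) y (hle y.2)) }
    have : Nontrivial H := (Subgroup.nontrivial_iff_ne_bot H).2 hne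
    have : Group.FG H := (Group.fg_iff_subgroup_fg H).2 hfg
    exact exists_hom_int_of_fg_of_torsionFree fun x k hk hx =>
      Subtype.ext (htf x (hle x.2) k hk (by simpa using congrArg Subtype.val hx))
  · have hfg' : (H.map f).FG := by
      classical
      obtain ⟨S, hS⟩ := hfg
      exact ⟨S.image f, by rw [Finset.coe_image, ← MonoidHom.map_closure, hS]⟩
    obtain ⟨φ, hφ⟩ := h (H.map f) hfg' hH
    refine ⟨φ.comp (f.subgroupMap H), fun h0 => hφ ?_⟩
    ext y
    obtain ⟨x, rfl⟩ := f.subgroupMap_surjective H y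
    exact DFunLike.congr_fun h0 x

theorem LocallyIndicable.of_subsingleton {Γ : Type*} [Group Γ] [Subsingleton Γ] :
    LocallyIndicable Γ := fun _ _ hne => absurd (Subsingleton.elim _ _) hne

/-! ### Supports in free modules over the group ring of a locally indicable group -/

variable {Γ : Type*} [Group Γ] {α : Type*}

/-- Left translation on `Γ × α`. -/
def shift (g : Γ) (e : Γ × α) : Γ × α := (g * e.1, e.2)

@[simp] theorem shift_one (e : Γ × α) : shift 1 e = e := by simp [shift]

theorem shift_shift (g h : Γ) (e : Γ × α) : shift g (shift h e) = shift (g * h) e := by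
  simp [shift, mul_assoc]

@[simp] theorem shift_inv_shift (g : Γ) (e : Γ × α) : shift g⁻¹ (shift g e) = e := by
  simp [shift]

@[simp] theorem shift_shift_inv (g : Γ) (e : Γ × α) : shift g (shift g⁻¹ e) = e := by
  simp [shift]

theorem shift_injective (g : Γ) : Function.Injective (shift g : Γ × α → Γ × α) :=
  Function.LeftInverse.injective (shift_inv_shift g)

theorem shift_right_cancel {g h : Γ} {e : Γ × α} (H : shift g e = shift h e) : g = h := by
  simpa [shift] using H

/-- A degree `deg` on `Γ × α` that is additive for translations of the elements of `D`: it exists,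
and it can be taken nonconstant on `D`, as soon as `D` has two elements. -/
theorem exists_degree (hΓ : LocallyIndicable Γ) {D : Finset (Γ × α)} (hD : D.Nontrivial) :
    ∃ (d : Γ → ℤ) (deg : Γ × α → ℤ), (∀ g, ∀ e ∈ D, deg (shift g e) = d g + deg e) ∧
      ∃ e ∈ D, ∃ e' ∈ D, deg e ≠ deg e' := by
  classical
  by_cases h : ∃ e ∈ D, ∃ e' ∈ D, e.2 ≠ e'.2
  · -- elements of `D` over different generators are told apart by an invariant function
    obtain ⟨e, he, e', he', hne⟩ := h
    refine ⟨fun _ => 0, fun x => if x.2 = e.2 then 1 else 0, fun g x _ => (zero_add _).symm,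
      e, he, e', he', ?_⟩
    simp [Ne.symm hne]
  · push Not at h
    obtain ⟨e₀, he₀, e₁, he₁, hne⟩ := hD
    let T : Finset Γ := D.image fun e => e₀.1⁻¹ * e.1
    let H : Subgroup Γ := Subgroup.closure (T : Set Γ)
    have hmem : ∀ e ∈ D, e₀.1⁻¹ * e.1 ∈ H := fun e he =>
      Subgroup.subset_closure (Finset.mem_coe.2 (Finset.mem_image_of_mem _ he))
    obtain ⟨φ, hφ⟩ := hΓ H ⟨T, rfl⟩ (by
      intro hbot
      have h1 := hmem e₁ he₁
      rw [hbot, Subgroup.mem_bot, inv_mul_eq_one] at h1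
      exact hne (Prod.ext h1 (h _ he₀ _ he₁)))
    have hout : ∀ x : Γ, (x : Γ ⧸ H).out⁻¹ * x ∈ H := fun x =>
      QuotientGroup.eq.1 (QuotientGroup.out_eq' _)
    -- the extension of `φ` to a map on `Γ` that is equivariant under right multiplication by `H`
    let δ : Γ → ℤ := fun x => (φ ⟨(x : Γ ⧸ H).out⁻¹ * x, hout x⟩).toAdd
    have hδ : ∀ (x : Γ) (y : H), δ (x * y) = δ x + (φ y).toAdd := by
      intro x y
      have h1 : ((x * y : Γ) : Γ ⧸ H) = (x : Γ ⧸ H) := by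
        rw [QuotientGroup.eq]; simp
      rw [← toAdd_mul, ← map_mul]
      simp only [δ]
      congr 2
      ext
      simp [h1, mul_assoc]
    have key : ∀ e (he : e ∈ D) g,
        δ (g * e.1) = δ (g * e₀.1) + (φ ⟨_, hmem e he⟩).toAdd := by
      intro e he g
      rw [← hδ]; simp [mul_assoc]
    refine ⟨fun g => δ (g * e₀.1) - δ e₀.1, fun e => δ e.1, fun g e he => ?_, ?_⟩
    · have h1 := key e he g
      have h2 := key e he 1
      simp only [one_mul] at h2
      simp only [shift]
      linarith
    · by_contra! hall
      apply hφ
      have h3 : ∀ e (he : e ∈ D), φ ⟨_, hmem e he⟩ = 1 := by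
        intro e he
        have h2 := key e he 1
        have := hall e he e₀ he₀
        simp only [one_mul] at h2
        apply Multiplicative.toAdd.injective
        rw [toAdd_one]; linarith
      ext ⟨y, hy⟩
      congr 1
      have hy' : y ∈ (φ.ker.map H.subtype) := by
        refine (Subgroup.closure_le _).2 ?_ hy
        intro t ht
        obtain ⟨e, he, rfl⟩ := Finset.mem_image.1 (Finset.mem_coe.1 ht)
        exact ⟨⟨_, hmem e he⟩, h3 e he, rfl⟩
      obtain ⟨z, hz, hzy⟩ := hy'
      have : z = ⟨y, hy⟩ := Subtype.ext hzy
      rw [← this]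
      exact hz

/-- Unique products: among the finitely many products `g e` with `g ∈ P`, `e ∈ D`, some product
arises only once. -/
theorem exists_unique_shift (hΓ : LocallyIndicable Γ) {P : Finset Γ} (hP : P.Nonempty) :
    ∀ {D : Finset (Γ × α)}, D.Nonempty →
      ∃ g ∈ P, ∃ e ∈ D, ∀ g' ∈ P, ∀ e' ∈ D, shift g' e' = shift g e → g' = g ∧ e' = e := by
  classical
  intro D
  induction hn : D.card using Nat.strong_induction_on generalizing D P with
  | _ n ih =>
  intro hD
  by_cases hnt : D.Nontrivial
  · obtain ⟨d, deg, hdeg, e₁, he₁, e₂, he₂, hne⟩ := exists_degree hΓ hnt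
    obtain ⟨gt, hgt, hgmax⟩ := P.exists_max_image d hP
    obtain ⟨et, het, hemax⟩ := D.exists_max_image deg hD
    have hlt : (D.filter fun e => deg e = deg et).card < n := by
      rw [← hn]
      refine Finset.card_lt_card (Finset.filter_ssubset.2 ?_)
      by_contra! hall
      exact hne ((hall e₁ he₁).trans (hall e₂ he₂).symm)
    obtain ⟨g, hg, e, he, huniq⟩ := ih _ hlt (P := P.filter fun g => d g = d gt)
      ⟨gt, by simp [hgt]⟩ rfl ⟨et, by simp [het]⟩
    rw [Finset.mem_filter] at hg he
    refine ⟨g, hg.1, e, he.1, fun g' hg' e' he' heq => ?_⟩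
    have h1 := congrArg deg heq
    rw [hdeg g' e' he', hdeg g e he.1] at h1
    have h2 := hgmax g' hg'
    have h3 := hemax e' he'
    exact huniq g' (Finset.mem_filter.2 ⟨hg', by linarith [hg.2, he.2]⟩) e'
      (Finset.mem_filter.2 ⟨he', by linarith [hg.2, he.2]⟩) heq
  · obtain ⟨g, hg⟩ := hP
    obtain ⟨e, he⟩ := hD
    refine ⟨g, hg, e, he, fun g' _ e' he' heq => ?_⟩
    have : e' = e := by
      by_contra hne
      exact hnt ⟨e', he', e, he, hne⟩
    subst this
    exact ⟨shift_right_cancel heq, rfl⟩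

/-- The action of the group ring element `p` on the element `m` of the free module on `α`. -/
noncomputable def conv (p : Γ →₀ ℚ) (m : Γ × α →₀ ℚ) : Γ × α →₀ ℚ :=
  p.sum fun g c => c • m.mapDomain (shift g)

theorem mapDomain_shift_apply (g : Γ) (m : Γ × α →₀ ℚ) (e : Γ × α) :
    m.mapDomain (shift g) e = m (shift g⁻¹ e) := by
  conv_lhs => rw [← shift_shift_inv g e]
  exact Finsupp.mapDomain_apply (shift_injective g) _ _

theorem conv_apply (p : Γ →₀ ℚ) (m : Γ × α →₀ ℚ) (e : Γ × α) :
    conv p m e = ∑ g ∈ p.support, p g * m (shift g⁻¹ e) := by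
  simp [conv, Finsupp.sum, Finsupp.finsetSum_apply, mapDomain_shift_apply]

theorem conv_sub (p q : Γ →₀ ℚ) (m : Γ × α →₀ ℚ) : conv (p - q) m = conv p m - conv q m := by
  simp only [conv]
  exact Finsupp.sum_sub_index fun g b c => sub_smul _ _ _

/-- If `conv p m e ≠ 0`, then `e` is a translate by the support of `p` of the support of `m`. -/
theorem exists_of_conv_ne_zero {p : Γ →₀ ℚ} {m : Γ × α →₀ ℚ} {e : Γ × α} (h : conv p m e ≠ 0) :
    ∃ g ∈ p.support, ∃ e' ∈ m.support, shift g e' = e := by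
  rw [conv_apply] at h
  obtain ⟨g, hg, hne⟩ := Finset.exists_ne_zero_of_sum_ne_zero h
  exact ⟨g, hg, shift g⁻¹ e, Finsupp.mem_support_iff.2 (right_ne_zero_of_mul hne), by simp⟩

/-- A product `conv p m` of nonzero factors has a nonzero coefficient in the top degree. -/
theorem exists_conv_ne_zero_of_top (hΓ : LocallyIndicable Γ) {p : Γ →₀ ℚ} {m : Γ × α →₀ ℚ}
    (hp : p ≠ 0) (hm : m ≠ 0) {d : Γ → ℤ} {deg : Γ × α → ℤ}
    (hdeg : ∀ g, ∀ e ∈ m.support, deg (shift g e) = d g + deg e) :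
    ∃ e, conv p m e ≠ 0 ∧ ∀ g ∈ p.support, ∀ e' ∈ m.support, d g + deg e' ≤ deg e := by
  classical
  obtain ⟨gt, hgt, hgmax⟩ := p.support.exists_max_image d (Finsupp.support_nonempty_iff.2 hp)
  obtain ⟨et, het, hemax⟩ := m.support.exists_max_image deg (Finsupp.support_nonempty_iff.2 hm)
  obtain ⟨g, hg, e, he, huniq⟩ := exists_unique_shift hΓ
    (P := p.support.filter fun g => d g = d gt) ⟨gt, Finset.mem_filter.2 ⟨hgt, rfl⟩⟩
    (D := m.support.filter fun e => deg e = deg et) ⟨et, Finset.mem_filter.2 ⟨het, rfl⟩⟩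
  rw [Finset.mem_filter] at hg he
  have hE := hdeg g e he.1
  refine ⟨shift g e, ?_, fun g' hg' e' he' => ?_⟩
  · rw [conv_apply, Finset.sum_eq_single_of_mem g hg.1]
    · rw [shift_inv_shift]
      exact mul_ne_zero (Finsupp.mem_support_iff.1 hg.1) (Finsupp.mem_support_iff.1 he.1)
    · intro g' hg' hne
      by_contra hne0
      have he' := Finsupp.mem_support_iff.2 (right_ne_zero_of_mul hne0)
      have h1 := hdeg g' _ he'
      rw [shift_shift_inv] at h1
      have h2 := hgmax g' hg'
      have h3 := hemax _ he'
      exact hne (huniq g' (Finset.mem_filter.2 ⟨hg', by linarith [hg.2, he.2]⟩) _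
        (Finset.mem_filter.2 ⟨he', by linarith [hg.2, he.2]⟩) (by simp)).1
  · have h2 := hgmax g' hg'
    have h3 := hemax e' he'
    linarith [hg.2, he.2]

/-- The top-degree part of `conv p m` is the product of the top-degree parts. -/
theorem conv_filter_top {p : Γ →₀ ℚ} {m : Γ × α →₀ ℚ} {d : Γ → ℤ} {deg : Γ × α → ℤ}
    (hdeg : ∀ g, ∀ e ∈ m.support, deg (shift g e) = d g + deg e) {a b : ℤ}
    (ha : ∀ g ∈ p.support, d g ≤ a) (hb : ∀ e ∈ m.support, deg e ≤ b) {e : Γ × α}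
    (he : deg e = a + b) :
    conv (p.filter fun g => d g = a) (m.filter fun e => deg e = b) e = conv p m e := by
  classical
  rw [conv_apply, conv_apply, Finsupp.support_filter, Finset.sum_filter]
  refine Finset.sum_congr rfl fun g hg => ?_
  by_cases hm : shift g⁻¹ e ∈ m.support
  · have h1 := hdeg g _ hm
    rw [shift_shift_inv] at h1
    have h2 := ha g hg
    have h3 := hb _ hm
    rw [if_pos (by linarith), Finsupp.filter_apply_pos _ _ (by linarith),
      Finsupp.filter_apply_pos _ _ (by linarith)]
  · have h0 := Finsupp.notMem_support_iff.1 hm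
    have h1 : m.filter (fun e => deg e = b) (shift g⁻¹ e) = 0 := by
      rw [Finsupp.filter_apply, h0, ite_self]
    rw [h0, h1]; simp

theorem card_support_filter_lt {X : Type*} {m : X →₀ ℚ} {deg : X → ℤ} {e₁ e₂ : X}
    (h₁ : e₁ ∈ m.support) (h₂ : e₂ ∈ m.support) (hne : deg e₁ ≠ deg e₂) (b : ℤ) :
    (m.filter fun e => deg e = b).support.card < m.support.card := by
  classical
  rw [Finsupp.support_filter]
  refine Finset.card_lt_card (Finset.filter_ssubset.2 ?_)
  by_contra! hall
  exact hne ((hall e₁ h₁).trans (hall e₂ h₂).symm)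

/-- A group ring element that does not enlarge the support of `m ≠ 0` is a scalar. -/
theorem support_subset_one_of_conv (hΓ : LocallyIndicable Γ) (p : Γ →₀ ℚ) :
    ∀ m : Γ × α →₀ ℚ, m ≠ 0 → (∀ e, conv p m e ≠ 0 → e ∈ m.support) → ∀ g ∈ p.support, g = 1 := by
  classical
  intro m
  induction hn : m.support.card using Nat.strong_induction_on generalizing m with
  | _ n ih =>
  intro hm hsup g hg
  have hp : p ≠ 0 := by rintro rfl; simp at hg
  by_cases hnt : m.support.Nontrivial
  · obtain ⟨d, deg, hdeg, e₁, he₁, e₂, he₂, hne⟩ := exists_degree hΓ hnt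
    obtain ⟨et, het, hemax⟩ := m.support.exists_max_image deg (Finsupp.support_nonempty_iff.2 hm)
    obtain ⟨eb, heb, hemin⟩ := m.support.exists_min_image deg (Finsupp.support_nonempty_iff.2 hm)
    have hd0 : ∀ g ∈ p.support, d g = 0 := by
      intro g hg
      obtain ⟨e, he, hle⟩ := exists_conv_ne_zero_of_top hΓ hp hm hdeg
      obtain ⟨e', he', hle'⟩ := exists_conv_ne_zero_of_top hΓ hp hm (d := fun g => -d g)
        (deg := fun e => -deg e) (fun g e he => by rw [hdeg g e he]; ring)
      have h1 := hle g hg et het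
      have h2 := hle' g hg eb heb
      have h3 := hemax e (hsup e he)
      have h4 := hemin e' (hsup e' he')
      linarith
    have htop : ∀ e, deg e = 0 + deg et → _ := fun e =>
      conv_filter_top (p := p) (e := e) hdeg (a := 0) (fun g hg => (hd0 g hg).le) hemax
    have hpf : p.filter (fun g => d g = 0) = p := Finsupp.filter_eq_self_iff _ _ |>.2
      fun g hg => hd0 g (Finsupp.mem_support_iff.2 hg)
    rw [hpf] at htop
    refine ih _ (hn ▸ card_support_filter_lt he₁ he₂ hne (deg et)) _ rfl ?_ ?_ g hg
    · intro h0
      have := DFunLike.congr_fun h0 et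
      rw [Finsupp.filter_apply_pos (fun e => deg e = deg et) m rfl] at this
      exact Finsupp.mem_support_iff.1 het this
    · intro e he
      obtain ⟨g', hg', e', he', rfl⟩ := exists_of_conv_ne_zero he
      rw [Finsupp.support_filter, Finset.mem_filter] at he'
      have hE : deg (shift g' e') = deg et := by rw [hdeg g' e' he'.1, hd0 g' hg', he'.2]; ring
      rw [Finsupp.support_filter, Finset.mem_filter]
      exact ⟨hsup _ (by rwa [← htop _ (by rw [hE]; ring)]), hE⟩
  · obtain ⟨e, he⟩ := Finsupp.support_nonempty_iff.2 hm
    have huni : ∀ e' ∈ m.support, e' = e := by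
      intro e' he'
      by_contra hne
      exact hnt ⟨e', he', e, he, hne⟩
    have h1 : conv p m (shift g e) ≠ 0 := by
      rw [conv_apply, Finset.sum_eq_single_of_mem g hg]
      · rw [shift_inv_shift]
        exact mul_ne_zero (Finsupp.mem_support_iff.1 hg) (Finsupp.mem_support_iff.1 he)
      · intro g' _ hne
        by_contra hne0
        have h2 := huni _ (Finsupp.mem_support_iff.2 (right_ne_zero_of_mul hne0))
        apply hne
        apply shift_right_cancel (e := e)
        conv_lhs => rw [← h2]
        simp
    have h2 := huni _ (hsup _ h1)
    exact shift_right_cancel (h2.trans (shift_one e).symm)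

/-- A finite set `Z ⊆ Γ × α` is saturated for `m` if the elements of the submodule generated by
`m` that are supported on `Z` are the combinations of the translates of `m` supported on `Z`. -/
def Saturated (m : Γ × α →₀ ℚ) (Z : Finset (Γ × α)) : Prop :=
  ∀ p : Γ →₀ ℚ, (∀ e, conv p m e ≠ 0 → e ∈ Z) → ∀ g ∈ p.support, ∀ e ∈ m.support, shift g e ∈ Z

/-- One degree after the other, from the top: the part of `Z` of the top degree is saturated for
the top-degree part of `m`, and the translates of `m` whose top-degree part it contains are added
to `Z` in the lower degrees. -/
theorem exists_saturated_of_degree (hΓ : LocallyIndicable Γ) {m : Γ × α →₀ ℚ} (hm : m ≠ 0)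
    {d : Γ → ℤ} {deg : Γ × α → ℤ}
    (hdeg : ∀ g, ∀ e ∈ m.support, deg (shift g e) = d g + deg e) {b : ℤ}
    (hb : ∀ e ∈ m.support, deg e ≤ b) (hb' : ∃ e ∈ m.support, deg e = b)
    (htop : ∀ Z₀ : Finset (Γ × α), ∃ Z, Z₀ ⊆ Z ∧ Saturated (m.filter fun e => deg e = b) Z)
    (a : ℤ) (n : ℕ) : ∀ Z₀ : Finset (Γ × α), (∀ e ∈ Z₀, a ≤ deg e ∧ deg e < a + n) →
      ∃ Z, Z₀ ⊆ Z ∧ (∀ e ∈ Z, a ≤ deg e ∧ deg e < a + n) ∧ Saturated m Z := by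
  classical
  induction n with
  | zero =>
    intro Z₀ hZ₀
    refine ⟨Z₀, Finset.Subset.refl _, hZ₀, fun p hp g hg => ?_⟩
    have hp0 : p ≠ 0 := by rintro rfl; simp at hg
    obtain ⟨e, he, -⟩ := exists_conv_ne_zero_of_top hΓ hp0 hm hdeg
    have := hZ₀ e (hp e he)
    push_cast at this
    omega
  | succ n ih =>
    intro Z₀ hZ₀
    obtain ⟨e₀, he₀, hde₀⟩ := hb'
    set c : ℤ := a + n with hc
    obtain ⟨Z₁, hZ₁, hsat₁⟩ := htop (Z₀.filter fun e => deg e = c)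
    set Zt := Z₁.filter fun e => deg e = c with hZt
    -- the translates of the top-degree part of `m` inside `Zt`
    let P : Finset Γ := (Zt.image fun e => e.1 * e₀.1⁻¹)
    let Y : Finset (Γ × α) := Z₀ ∪ (P ×ˢ m.support).image fun x => shift x.1 x.2
    obtain ⟨Z', hZ', hdeg', hsat'⟩ := ih (Y.filter fun e => a ≤ deg e ∧ deg e < c) fun e he =>
      (Finset.mem_filter.1 he).2
    refine ⟨Zt ∪ Z', fun e he => ?_, fun e he => ?_, fun p hp g hg e he => ?_⟩
    · have h1 := hZ₀ e he
      push_cast at h1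
      rcases eq_or_ne (deg e) c with h | h
      · exact Finset.mem_union_left _ (Finset.mem_filter.2 ⟨hZ₁ (Finset.mem_filter.2 ⟨he, h⟩), h⟩)
      · exact Finset.mem_union_right _ (hZ' (Finset.mem_filter.2
          ⟨Finset.mem_union_left _ he, h1.1, by omega⟩))
    · push_cast
      rcases Finset.mem_union.1 he with h | h
      · have := (Finset.mem_filter.1 h).2; omega
      · have := hdeg' e h; omega
    · have hp0 : p ≠ 0 := by rintro rfl; simp at hg
      have hrange : ∀ e, conv p m e ≠ 0 → a ≤ deg e ∧ deg e ≤ c := by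
        intro e he
        rcases Finset.mem_union.1 (hp e he) with h | h
        · have := (Finset.mem_filter.1 h).2; omega
        · have := hdeg' e h; omega
      -- all translates `g m` with `g` in the support of `p` have degrees in `[a, c]`
      have hcell : ∀ g ∈ p.support, ∀ e ∈ m.support, a ≤ d g + deg e ∧ d g + deg e ≤ c := by
        intro g hg e he
        obtain ⟨e₁, h₁, hle₁⟩ := exists_conv_ne_zero_of_top hΓ hp0 hm hdeg
        obtain ⟨e₂, h₂, hle₂⟩ := exists_conv_ne_zero_of_top hΓ hp0 hm (d := fun g => -d g)
          (deg := fun e => -deg e) (fun g e he => by rw [hdeg g e he]; ring)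
        have := hle₁ g hg e he
        have := hle₂ g hg e he
        have := hrange e₁ h₁
        have := hrange e₂ h₂
        omega
      have ha : ∀ g ∈ p.support, d g ≤ c - b := by
        intro g hg
        have := hcell g hg e₀ he₀
        omega
      set q := p.filter fun g => d g = c - b with hq
      have hqsat : ∀ g ∈ q.support, ∀ e ∈ m.support, shift g e ∈ Zt ∪ Z' := by
        intro g hg
        have hg' := hg
        rw [hq, Finsupp.support_filter, Finset.mem_filter] at hg
        have h1 := hsat₁ q (fun e he => by
          obtain ⟨g', hg', e', he', rfl⟩ := exists_of_conv_ne_zero he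
          rw [Finsupp.support_filter, Finset.mem_filter] at hg' he'
          have hE : deg (shift g' e') = c - b + b := by rw [hdeg g' e' he'.1, hg'.2, he'.2]
          rw [conv_filter_top hdeg ha hb hE] at he
          rcases Finset.mem_union.1 (hp _ he) with h | h
          · exact (Finset.mem_filter.1 h).1
          · have := hdeg' _ h; omega) g hg'
        have hgP : g ∈ P := by
          refine Finset.mem_image.2 ⟨shift g e₀, Finset.mem_filter.2 ⟨h1 e₀ ?_, ?_⟩, ?_⟩
          · rw [Finsupp.support_filter, Finset.mem_filter]; exact ⟨he₀, hde₀⟩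
          · rw [hdeg g e₀ he₀, hg.2, hde₀]; ring
          · simp [shift]
        intro e he
        have h2 := hcell g hg.1 e he
        rw [← hdeg g e he] at h2
        rcases eq_or_ne (deg (shift g e)) c with h | h
        · refine Finset.mem_union_left _ (Finset.mem_filter.2 ⟨h1 e ?_, h⟩)
          rw [Finsupp.support_filter, Finset.mem_filter]
          rw [hdeg g e he, hg.2] at h
          exact ⟨he, by omega⟩
        · refine Finset.mem_union_right _ (hZ' (Finset.mem_filter.2
            ⟨Finset.mem_union_right _ (Finset.mem_image.2
              ⟨(g, e), Finset.mem_product.2 ⟨hgP, he⟩, rfl⟩), h2.1, by omega⟩))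
      by_cases hgd : d g = c - b
      · exact hqsat g (by rw [hq, Finsupp.support_filter, Finset.mem_filter]; exact ⟨hg, hgd⟩) e he
      · refine Finset.mem_union_right _ (hsat' (p - q) (fun x hx => ?_) g ?_ e he)
        · rw [conv_sub] at hx
          have hx' : x ∈ Zt ∪ Z' := by
            by_contra hxZ
            apply hx
            have h1 : conv p m x = 0 := by
              by_contra h; exact hxZ (hp x h)
            have h2 : conv q m x = 0 := by
              by_contra h
              obtain ⟨g', hg', e', he', rfl⟩ := exists_of_conv_ne_zero h
              exact hxZ (hqsat g' hg' e' he')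
            simp [h1, h2]
          rcases Finset.mem_union.1 hx' with h | h
          · exfalso
            rw [← conv_sub] at hx
            obtain ⟨g', hg', e', he', rfl⟩ := exists_of_conv_ne_zero hx
            have h3 := (Finset.mem_filter.1 h).2
            rw [hdeg g' e' he'] at h3
            have h4 : d g' ≠ c - b := by
              intro h5
              rw [Finsupp.mem_support_iff, Finsupp.sub_apply, hq,
                Finsupp.filter_apply_pos (fun g => d g = c - b) p h5, sub_self] at hg'
              exact hg' rfl
            have h6 : g' ∈ p.support := by
              rw [Finsupp.mem_support_iff, Finsupp.sub_apply, hq,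
                Finsupp.filter_apply_neg (fun g => d g = c - b) p h4, sub_zero] at hg'
              exact Finsupp.mem_support_iff.2 hg'
            have := ha g' h6
            have := hb e' he'
            omega
          · exact h
        · rw [Finsupp.mem_support_iff, Finsupp.sub_apply, hq, Finsupp.filter_apply_neg (fun g => d g = c - b) p hgd,
            sub_zero]
          exact Finsupp.mem_support_iff.1 hg

theorem exists_saturated (hΓ : LocallyIndicable Γ) (m : Γ × α →₀ ℚ) :
    ∀ Z₀ : Finset (Γ × α), ∃ Z, Z₀ ⊆ Z ∧ Saturated m Z := by
  classical
  induction hn : m.support.card using Nat.strong_induction_on generalizing m with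
  | _ n ih =>
  intro Z₀
  by_cases hnt : m.support.Nontrivial
  · obtain ⟨d, deg, hdeg, e₁, he₁, e₂, he₂, hne⟩ := exists_degree hΓ hnt
    obtain ⟨et, het, hemax⟩ := m.support.exists_max_image deg hnt.nonempty
    have hm : m ≠ 0 := Finsupp.support_nonempty_iff.1 hnt.nonempty
    obtain ⟨B, hB⟩ : ∃ B : ℕ, ∀ e ∈ Z₀, -(B : ℤ) ≤ deg e ∧ deg e < B := by
      refine ⟨(Z₀.sup fun e => (deg e).natAbs) + 1, fun e he => ?_⟩
      have := Finset.le_sup (f := fun e => (deg e).natAbs) he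
      push_cast
      omega
    obtain ⟨Z, hZ, -, hsat⟩ := exists_saturated_of_degree hΓ hm hdeg hemax ⟨et, het, rfl⟩
      (ih _ (hn ▸ card_support_filter_lt he₁ he₂ hne (deg et)) _ rfl) (-(B : ℤ)) (2 * B) Z₀
      (fun e he => by have := hB e he; push_cast; omega)
    exact ⟨Z, hZ, hsat⟩
  · refine ⟨Z₀, Finset.Subset.refl _, fun p hp g hg e he => hp _ ?_⟩
    have huni : ∀ e' ∈ m.support, e' = e := by
      intro e' he'
      by_contra hne
      exact hnt ⟨e', he', e, he, hne⟩
    rw [conv_apply, Finset.sum_eq_single_of_mem g hg]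
    · rw [shift_inv_shift]
      exact mul_ne_zero (Finsupp.mem_support_iff.1 hg) (Finsupp.mem_support_iff.1 he)
    · intro g' _ hne
      by_contra hne0
      have h2 := huni _ (Finsupp.mem_support_iff.2 (right_ne_zero_of_mul hne0))
      apply hne
      apply shift_right_cancel (e := e)
      conv_lhs => rw [← h2]
      simp

/-! ### Paths in Cayley graphs and their homology classes -/

section Class

variable {X Y : Type*}

/-- The class of `y` in the rational homology `X →₀ ℚ` of the free group on `X`. -/
noncomputable def cls (y : FreeGroup X) : X →₀ ℚ :=
  (FreeGroup.lift (fun e => Multiplicative.ofAdd (Finsupp.single e (1 : ℚ))) y).toAdd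

@[simp] theorem cls_one : cls (1 : FreeGroup X) = 0 := by simp [cls]
@[simp] theorem cls_mul (x y : FreeGroup X) : cls (x * y) = cls x + cls y := by simp [cls]
@[simp] theorem cls_inv (x : FreeGroup X) : cls x⁻¹ = -cls x := by simp [cls]
@[simp] theorem cls_of (e : X) : cls (FreeGroup.of e) = Finsupp.single e 1 := by simp [cls]
theorem cls_pow (x : FreeGroup X) (k : ℕ) : cls (x ^ k) = k • cls x := by simp [cls]
theorem cls_zpow (x : FreeGroup X) (k : ℤ) : cls (x ^ k) = k • cls x := by simp [cls]

theorem cls_map (f : X → Y) (y : FreeGroup X) :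
    cls (FreeGroup.map f y) = (cls y).mapDomain f := by
  induction y using FreeGroup.induction_on with
  | C1 => simp
  | of x => simp [Finsupp.mapDomain_single]
  | inv_of x h => rw [map_inv, cls_inv, h, cls_inv]; exact (map_neg (Finsupp.lmapDomain ℚ ℚ f) _).symm
  | mul x y hx hy => rw [map_mul, cls_mul, hx, hy, cls_mul, Finsupp.mapDomain_add]

theorem mem_commutator_of_cls_eq_zero {y : FreeGroup X} (hy : cls y = 0) :
    y ∈ commutator (FreeGroup X) := by
  let c : FreeGroup X →* Multiplicative (X →₀ ℤ) :=
    FreeGroup.lift fun e => Multiplicative.ofAdd (Finsupp.single e 1)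
  have hc : ∀ y e, cls y e = ((c y).toAdd e : ℚ) := by
    intro y e
    induction y using FreeGroup.induction_on with
    | C1 => simp
    | of x => classical simp [c, Finsupp.single_apply]
    | inv_of x h => rw [cls_inv, Finsupp.neg_apply, h, map_inv]; simp
    | mul x y hx hy => rw [cls_mul, Finsupp.add_apply, hx, hy, map_mul]; simp
  let f : (X →₀ ℤ) →+ Additive (Abelianization (FreeGroup X)) :=
    Finsupp.liftAddHom fun x =>
      zmultiplesHom _ (Additive.ofMul (Abelianization.of (FreeGroup.of x)))
  have hf : (AddMonoidHom.toMultiplicativeLeft f).comp c = Abelianization.of := by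
    ext x; simp [c, f]
  have h0 : c y = 1 := by
    apply Multiplicative.toAdd.injective
    ext e
    have := hc y e
    rw [hy, Finsupp.zero_apply] at this
    exact_mod_cast this.symm
  rw [← Abelianization.ker_of, MonoidHom.mem_ker, ← hf, MonoidHom.comp_apply, h0, map_one]

theorem mk_cons_true (e : X) (l : List (X × Bool)) :
    FreeGroup.mk ((e, true) :: l) = FreeGroup.of e * FreeGroup.mk l := by
  simp [FreeGroup.of]

theorem mk_cons_false (e : X) (l : List (X × Bool)) :
    FreeGroup.mk ((e, false) :: l) = (FreeGroup.of e)⁻¹ * FreeGroup.mk l := by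
  simp [FreeGroup.of, FreeGroup.invRev]

theorem cls_mk_cons (x : X × Bool) (l : List (X × Bool)) :
    cls (FreeGroup.mk (x :: l)) =
      Finsupp.single x.1 (if x.2 then 1 else -1) + cls (FreeGroup.mk l) := by
  obtain ⟨e, _ | _⟩ := x
  · rw [mk_cons_false]; simp
  · rw [mk_cons_true]; simp

theorem cls_mk_apply_of_notMem {l : List (X × Bool)} {e : X} (h : e ∉ l.map Prod.fst) :
    cls (FreeGroup.mk l) e = 0 := by
  classical
  induction l with
  | nil => simp [FreeGroup.one_eq_mk.symm]
  | cons x l ih =>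
    rw [List.map_cons, List.mem_cons, not_or] at h
    rw [cls_mk_cons, Finsupp.add_apply, ih h.2, Finsupp.single_apply, if_neg (Ne.symm h.1), add_zero]

theorem cls_mk_apply_of_mem {l : List (X × Bool)} (hl : (l.map Prod.fst).Nodup) {e : X}
    {b : Bool} (h : (e, b) ∈ l) : cls (FreeGroup.mk l) e = if b then 1 else -1 := by
  classical
  induction l with
  | nil => simp at h
  | cons x l ih =>
    rw [List.map_cons, List.nodup_cons] at hl
    rw [cls_mk_cons, Finsupp.add_apply]
    rcases List.mem_cons.1 h with rfl | h
    · rw [cls_mk_apply_of_notMem hl.1]; simp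
    · have hne : x.1 ≠ e := fun hx => hl.1 (hx ▸ List.mem_map_of_mem h)
      rw [ih hl.2 h, Finsupp.single_eq_of_ne' hne, zero_add]

theorem mem_support_cls_mk {l : List (X × Bool)} (hl : (l.map Prod.fst).Nodup) {e : X} :
    e ∈ (cls (FreeGroup.mk l)).support ↔ e ∈ l.map Prod.fst := by
  rw [Finsupp.mem_support_iff]
  refine ⟨fun h => by_contra fun h' => h (cls_mk_apply_of_notMem h'), fun h => ?_⟩
  obtain ⟨⟨e, b⟩, hx, rfl⟩ := List.mem_map.1 h
  rw [cls_mk_apply_of_mem hl hx]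
  cases b <;> norm_num

theorem lift_mk_congr {U : Type*} [Group U] {θ θ' : X → U} {l : List (X × Bool)}
    (h : ∀ e ∈ l.map Prod.fst, θ e = θ' e) :
    FreeGroup.lift θ (FreeGroup.mk l) = FreeGroup.lift θ' (FreeGroup.mk l) := by
  rw [FreeGroup.lift_mk, FreeGroup.lift_mk]
  congr 1
  refine List.map_congr_left fun x hx => ?_
  rw [h x.1 (List.mem_map_of_mem hx)]

end Class

section Path

variable {α Γ : Type*} [Group Γ] (π : FreeGroup α →* Γ)

/-- The action of the free group on the Cayley graph of `Γ` with respect to the generators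
`π (FreeGroup.of a)`: the pair `(g, a) : Γ × α` stands for the edge from `g` to
`g * π (FreeGroup.of a)`, and `x` is sent to the labels of its lifts at all vertices, together with
`π x`. -/
def pathHom : FreeGroup α →* RegularWreathProduct (FreeGroup (Γ × α)) Γ :=
  FreeGroup.lift fun a => ⟨fun g => FreeGroup.of (g⁻¹, a), π (FreeGroup.of a)⟩

/-- The path in the Cayley graph of `Γ` that starts at the vertex `g` and reads `x`, as an element
of the free group on the edges. -/
def path (g : Γ) (x : FreeGroup α) : FreeGroup (Γ × α) := (pathHom π x).left g⁻¹

theorem pathHom_right (x : FreeGroup α) : (pathHom π x).right = π x := by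
  have : RegularWreathProduct.rightHom.comp (pathHom π) = π := by
    ext a; simp [pathHom]
  exact DFunLike.congr_fun this x

@[simp] theorem path_of (g : Γ) (a : α) : path π g (FreeGroup.of a) = FreeGroup.of (g, a) := by
  simp [path, pathHom]

@[simp] theorem path_one (g : Γ) : path π g 1 = 1 := by
  simp [path]

theorem path_mul (g : Γ) (x y : FreeGroup α) :
    path π g (x * y) = path π g x * path π (g * π x) y := by
  simp [path, pathHom_right]

theorem path_inv (g : Γ) (x : FreeGroup α) :
    path π g x⁻¹ = (path π (g * (π x)⁻¹) x)⁻¹ := by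
  simp [path, pathHom_right]

theorem path_conj (y : FreeGroup α) {x : FreeGroup α} (hx : π x = 1) (g : Γ) :
    path π g (y * x * y⁻¹) = path π g y * path π (g * π y) x * (path π g y)⁻¹ := by
  simp [path_mul, path_inv, hx, mul_assoc]

theorem path_mul_left (h g : Γ) (x : FreeGroup α) :
    path π (h * g) x = FreeGroup.map (shift h) (path π g x) := by
  induction x using FreeGroup.induction_on generalizing g with
  | C1 => simp
  | of a => simp [shift]
  | inv_of a ih => rw [path_inv, path_inv, mul_assoc, ih, map_inv]
  | mul x y hx hy => rw [path_mul, path_mul, mul_assoc, hx, hy, map_mul]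

theorem cls_path (g : Γ) (x : FreeGroup α) :
    cls (path π g x) = (cls (path π 1 x)).mapDomain (shift g) := by
  rw [← cls_map, ← path_mul_left, mul_one]

theorem path_comp {Γ' : Type*} [Group Γ'] (q : Γ →* Γ') (g : Γ) (x : FreeGroup α) :
    path (q.comp π) (q g) x = FreeGroup.map (Prod.map q id) (path π g x) := by
  induction x using FreeGroup.induction_on generalizing g with
  | C1 => simp
  | of a => simp
  | inv_of a ih =>
    rw [path_inv, path_inv, map_inv, ← ih, map_mul, map_inv, MonoidHom.comp_apply]
  | mul x y hx hy =>
    rw [path_mul, path_mul, map_mul, hx, ← hy, map_mul, MonoidHom.comp_apply]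

/-- The image of a path under the homomorphism that sends the edge from `g` to `h` labelled `a`
to `t g * a * (t h)⁻¹`. -/
theorem lift_path (t : Γ → FreeGroup α) (g : Γ) (x : FreeGroup α) :
    FreeGroup.lift (fun e : Γ × α => t e.1 * FreeGroup.of e.2 * (t (e.1 * π (FreeGroup.of e.2)))⁻¹)
      (path π g x) = t g * x * (t (g * π x))⁻¹ := by
  induction x using FreeGroup.induction_on generalizing g with
  | C1 => simp
  | of a => simp
  | inv_of a ih => rw [path_inv, map_inv, ih]; simp [mul_assoc]
  | mul x y hx hy => rw [path_mul, map_mul, hx, hy]; simp [mul_assoc]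

/-- A closed path that is null-homologous in the Cayley graph of `FreeGroup α ⧸ K`, where `K` is the
kernel of `π`, lies in `⁅K, K⁆`. -/
theorem mem_commutator_of_cls_path_eq_zero (hπ : Function.Surjective π) {x : FreeGroup α}
    (hx : x ∈ π.ker) (h : cls (path π 1 x) = 0) : x ∈ ⁅π.ker, π.ker⁆ := by
  -- a section `t` of `π` maps the paths back to words, and the free group on the edges to the kernel
  let t : Γ → FreeGroup α := Function.surjInv hπ
  have ht : ∀ g, π (t g) = g := Function.surjInv_eq hπ
  let ψ := FreeGroup.lift
    (fun e : Γ × α => t e.1 * FreeGroup.of e.2 * (t (e.1 * π (FreeGroup.of e.2)))⁻¹)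
  have hψ : ψ.range ≤ π.ker := by
    refine FreeGroup.range_lift_le ?_
    rintro _ ⟨e, rfl⟩
    simp [MonoidHom.mem_ker, ht]
  have h1 : ψ (path π 1 x) ∈ ⁅π.ker, π.ker⁆ := by
    have h2 : ψ (path π 1 x) ∈ (commutator _).map ψ :=
      Subgroup.mem_map_of_mem _ (mem_commutator_of_cls_eq_zero h)
    rw [commutator_def, Subgroup.map_commutator, ← MonoidHom.range_eq_map] at h2
    exact Subgroup.commutator_mono hψ hψ h2
  rw [lift_path, one_mul, (MonoidHom.mem_ker.1 hx)] at h1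
  have h3 := (inferInstance : (⁅π.ker, π.ker⁆).Normal).conj_mem _ h1 (t 1)⁻¹
  simpa [mul_assoc] using h3

/-- For `K` the kernel of `π`, the classes of the elements of `⁅K, K⁆ ⟨⟨w⟩⟩` are multiples of the class
of `w` by group ring elements. -/
theorem exists_cls_path_eq_conv {w : FreeGroup α} (hw : w ∈ π.ker)
    {x : FreeGroup α} (hx : x ∈ ⁅π.ker, π.ker⁆ ⊔ Subgroup.normalClosure {w}) :
    ∃ p : Γ →₀ ℚ, cls (path π 1 x) = conv p (cls (path π 1 w)) := by
  let M : Submodule ℚ (Γ × α →₀ ℚ) :=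
    Submodule.span ℚ (Set.range fun g => (cls (path π 1 w)).mapDomain (shift g))
  have hM : ∀ g, ∀ v ∈ M, v.mapDomain (shift g) ∈ M := by
    intro g v hv
    have h1 : M ≤ M.comap (Finsupp.lmapDomain ℚ ℚ (shift g)) := by
      refine Submodule.span_le.2 ?_
      rintro _ ⟨h, rfl⟩
      refine Submodule.subset_span ⟨g * h, ?_⟩
      simp only [Finsupp.lmapDomain_apply]
      rw [← Finsupp.mapDomain_comp]
      congr 1
      ext1 e
      exact (shift_shift g h e).symm
    exact h1 hv
  let S : Subgroup (FreeGroup α) :=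
    { carrier := {x | x ∈ π.ker ∧ cls (path π 1 x) ∈ M}
      one_mem' := ⟨one_mem _, by simp⟩
      mul_mem' := fun {x y} hx hy => ⟨mul_mem hx.1 hy.1, by
        rw [path_mul, MonoidHom.mem_ker.1 hx.1, mul_one, cls_mul]
        exact add_mem hx.2 hy.2⟩
      inv_mem' := fun {x} hx => ⟨inv_mem hx.1, by
        rw [path_inv, MonoidHom.mem_ker.1 hx.1, inv_one, mul_one, cls_inv]
        exact neg_mem hx.2⟩ }
  have hS : S.Normal := ⟨fun x hx y => ⟨(MonoidHom.normal_ker π).conj_mem x hx.1 y, by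
    rw [path_conj π y hx.1, cls_mul, cls_mul, cls_inv, one_mul, cls_path _ (π y)]
    have := hM (π y) _ hx.2
    simpa using this⟩⟩
  have h1 : ⁅π.ker, π.ker⁆ ≤ S := by
    rw [Subgroup.commutator_le]
    intro x hx y hy
    have hx' := MonoidHom.mem_ker.1 hx
    have hy' := MonoidHom.mem_ker.1 hy
    refine ⟨?_, ?_⟩
    · rw [MonoidHom.mem_ker, map_commutatorElement, hx', hy']; simp
    · rw [commutatorElement_def]
      simp [path_mul, path_inv, hx', hy']
  have h2 : Subgroup.normalClosure {w} ≤ S := by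
    refine Subgroup.normalClosure_le_normal ?_
    rintro _ rfl
    refine ⟨hw, Submodule.subset_span ⟨1, ?_⟩⟩
    have : (shift 1 : Γ × α → Γ × α) = id := by ext1 e; simp
    simp only [this]
    exact Finsupp.mapDomain_id
  obtain ⟨p, hp⟩ := Finsupp.mem_span_range_iff_exists_finsupp.1 ((sup_le h1 h2) hx).2
  exact ⟨p, hp.symm⟩

/-- The list of the oriented edges of the path that starts at `g` and reads the word `l`; the edge
`e` traversed backwards is `(e, false)`. -/
def pathList (g : Γ) : List (α × Bool) → List ((Γ × α) × Bool)
  | [] => []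
  | (a, true) :: l => ((g, a), true) :: pathList (g * π (FreeGroup.of a)) l
  | (a, false) :: l =>
    ((g * (π (FreeGroup.of a))⁻¹, a), false) :: pathList (g * (π (FreeGroup.of a))⁻¹) l

theorem path_mk (g : Γ) (l : List (α × Bool)) :
    path π g (FreeGroup.mk l) = FreeGroup.mk (pathList π g l) := by
  induction l generalizing g with
  | nil => simp [pathList, ← FreeGroup.one_eq_mk]
  | cons x l ih =>
    obtain ⟨a, _ | _⟩ := x
    · rw [mk_cons_false, path_mul, path_inv, path_of, ih, map_inv, pathList, mk_cons_false]
    · rw [mk_cons_true, path_mul, path_of, ih, pathList, mk_cons_true]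

theorem pathList_comp {Γ' : Type*} [Group Γ'] (q : Γ →* Γ') (g : Γ) (l : List (α × Bool)) :
    pathList (q.comp π) (q g) l = (pathList π g l).map (Prod.map (Prod.map q id) id) := by
  induction l generalizing g with
  | nil => simp [pathList]
  | cons x l ih =>
    obtain ⟨a, _ | _⟩ := x <;> simp [pathList, ← ih]

theorem pathList_mul_left (h g : Γ) (l : List (α × Bool)) :
    pathList π (h * g) l = (pathList π g l).map (Prod.map (shift h) id) := by
  induction l generalizing g with
  | nil => simp [pathList]
  | cons x l ih =>
    obtain ⟨a, _ | _⟩ := x <;> simp [pathList, ← ih, shift, mul_assoc]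

@[simp] theorem length_pathList (g : Γ) (l : List (α × Bool)) :
    (pathList π g l).length = l.length := by
  induction l generalizing g with
  | nil => simp [pathList]
  | cons x l ih => obtain ⟨a, _ | _⟩ := x <;> simp [pathList, ih]

end Path

/-! ### Eliminating edges of simple closed paths -/

/-- The edge `f` of an edge-simple closed path `l = x f y` is eliminated by `f ↦ x⁻¹ y⁻¹`. This does
not affect homomorphisms that kill `l`. -/
theorem exists_eliminate {X : Type*} {l : List (X × Bool)} (hl : (l.map Prod.fst).Nodup) {f : X}
    (hf : f ∈ l.map Prod.fst) :
    ∃ τ : X → FreeGroup X, FreeGroup.lift τ (FreeGroup.mk l) = 1 ∧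
      (∀ e, e ≠ f → τ e = FreeGroup.of e) ∧
      ∀ {Q : Type*} [Group Q] (ψ : FreeGroup X →* Q), ψ (FreeGroup.mk l) = 1 →
        ψ (τ f) = ψ (FreeGroup.of f) := by
  classical
  obtain ⟨⟨f, b⟩, hfl, rfl⟩ := List.mem_map.1 hf
  obtain ⟨l₁, l₂, rfl⟩ := List.append_of_mem hfl
  rw [List.map_append, List.map_cons, List.nodup_middle, List.nodup_cons, List.mem_append,
    not_or] at hl
  set x := FreeGroup.mk l₁ with hx
  set y := FreeGroup.mk l₂ with hy
  have hlift : ∀ (u : FreeGroup X) (l : List (X × Bool)), f ∉ l.map Prod.fst →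
      FreeGroup.lift (Function.update FreeGroup.of f u) (FreeGroup.mk l) = FreeGroup.mk l := by
    intro u l hl
    rw [lift_mk_congr (θ' := FreeGroup.of) fun e he =>
      Function.update_of_ne (ne_of_mem_of_not_mem he hl) _ _]
    exact FreeGroup.lift_of_apply _
  have key : FreeGroup.mk (l₁ ++ (f, b) :: l₂) =
      x * (bif b then FreeGroup.of f else (FreeGroup.of f)⁻¹) * y := by
    rw [← FreeGroup.mul_mk, mul_assoc]
    congr 1
    cases b
    · exact mk_cons_false _ _
    · exact mk_cons_true _ _
  set u := x⁻¹ * y⁻¹ with hu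
  refine ⟨Function.update FreeGroup.of f (bif b then u else u⁻¹), ?_, fun e he =>
    Function.update_of_ne he _ _, fun ψ hψ => ?_⟩
  · rw [key, map_mul, map_mul, hlift _ _ hl.1.1, hlift _ _ hl.1.2, ← hx, ← hy]
    cases b <;> simp [hu]
  · rw [key, map_mul, map_mul] at hψ
    have gen : ∀ z, ψ x * z * ψ y = 1 → (ψ x)⁻¹ * (ψ y)⁻¹ = z := by
      intro z hz
      rw [← eq_inv_of_mul_eq_one_left hz, inv_mul_cancel_left]
    rw [Function.update_self]
    cases b
    · have := gen _ hψ
      simp only [cond_false, map_inv, hu, map_mul] at this ⊢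
      rw [this, inv_inv]
    · have := gen _ hψ
      simpa only [cond_true, map_inv, hu, map_mul] using this

theorem mk_map_shift {Γ α : Type*} [Group Γ] (g : Γ) (l : List ((Γ × α) × Bool)) :
    FreeGroup.map (shift g) (FreeGroup.mk l) = FreeGroup.mk (l.map (Prod.map (shift g) id)) := by
  rw [FreeGroup.map.mk]; rfl

/-- Finitely many translates of an edge-simple closed path `l` can be collapsed: each of them has
an edge of its own once the translates are suitably ordered, and this edge is eliminated. -/
theorem exists_collapse {Γ α : Type*} [Group Γ] (hΓ : LocallyIndicable Γ)
    {l : List ((Γ × α) × Bool)} (hl : (l.map Prod.fst).Nodup) (hne : l ≠ []) (P : Finset Γ) :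
    ∃ σ : Γ × α → FreeGroup (Γ × α),
      (∀ g ∈ P, FreeGroup.lift σ (FreeGroup.map (shift g) (FreeGroup.mk l)) = 1) ∧
      ∀ {Q : Type*} [Group Q] (ψ : FreeGroup (Γ × α) →* Q),
        (∀ g ∈ P, ψ (FreeGroup.map (shift g) (FreeGroup.mk l)) = 1) →
          ψ.comp (FreeGroup.lift σ) = ψ := by
  classical
  induction hn : P.card generalizing P with
  | zero =>
    rw [Finset.card_eq_zero] at hn
    subst hn
    refine ⟨FreeGroup.of, by simp, fun ψ _ => ?_⟩
    ext; simp
  | succ n ih =>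
    have hP : P.Nonempty := Finset.card_pos.1 (by omega)
    obtain ⟨x, hx⟩ := List.exists_mem_of_ne_nil l hne
    obtain ⟨g, hg, e, he, huniq⟩ := exists_unique_shift hΓ hP
      (D := (l.map Prod.fst).toFinset) ⟨x.1, List.mem_toFinset.2 (List.mem_map_of_mem hx)⟩
    rw [List.mem_toFinset] at he
    have hfst : ∀ g, (l.map (Prod.map (shift g) id)).map Prod.fst =
        (l.map Prod.fst).map (shift g) := by
      intro g; simp [Function.comp_def]
    obtain ⟨τ, hτ, hτne, hτψ⟩ := exists_eliminate (l := l.map (Prod.map (shift g) id))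
      (f := shift g e) (by rw [hfst]; exact hl.map (shift_injective g))
      (by rw [hfst]; exact List.mem_map_of_mem he)
    obtain ⟨σ, hσ, hσψ⟩ := ih (P.erase g) (by rw [Finset.card_erase_of_mem hg]; omega)
    have hcomp : ∀ y, FreeGroup.lift (fun e => FreeGroup.lift σ (τ e)) y =
        FreeGroup.lift σ (FreeGroup.lift τ y) := by
      intro y
      have : FreeGroup.lift (fun e => FreeGroup.lift σ (τ e)) =
          (FreeGroup.lift σ).comp (FreeGroup.lift τ) := by ext; simp
      rw [this]; rfl
    refine ⟨fun e => FreeGroup.lift σ (τ e), fun g' hg' => ?_, fun ψ hψ => ?_⟩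
    · rw [hcomp]
      by_cases h : g' = g
      · rw [h, mk_map_shift, hτ, map_one]
      · rw [← hσ g' (Finset.mem_erase.2 ⟨h, hg'⟩)]
        congr 1
        rw [mk_map_shift, lift_mk_congr (θ' := FreeGroup.of)]
        · exact FreeGroup.lift_of_apply _
        · intro f hf
          rw [hfst] at hf
          obtain ⟨e', he', rfl⟩ := List.mem_map.1 hf
          exact hτne _ fun h' => h (huniq g' hg' e' (List.mem_toFinset.2 he') h').1
    · have h1 := hσψ ψ fun g' hg' => hψ g' (Finset.mem_of_mem_erase hg')
      ext f
      have h2 : ψ (FreeGroup.lift σ (τ f)) = ψ (τ f) := DFunLike.congr_fun h1 (τ f)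
      rw [MonoidHom.comp_apply, FreeGroup.lift_apply_of, h2]
      by_cases hf : f = shift g e
      · rw [hf]
        exact hτψ ψ (by rw [← mk_map_shift]; exact hψ g hg)
      · rw [hτne f hf]

/-! ### Filtered algebras and homomorphisms to their unipotent units -/

/-- A multiplicative descending filtration of a `ℚ`-algebra by submodules. -/
structure Filtration (A : Type*) [Ring A] [Algebra ℚ A] where
  /-- The terms of the filtration. -/
  term : ℕ → Submodule ℚ A
  one_mem_term : 1 ∈ term 0
  succ_le : ∀ k, term (k + 1) ≤ term k
  mul_mem_term : ∀ {a b x y}, x ∈ term a → y ∈ term b → x * y ∈ term (a + b)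

namespace Filtration

variable {A : Type*} [Ring A] [Algebra ℚ A] (I : Filtration A)

theorem anti {a b : ℕ} (h : a ≤ b) : I.term b ≤ I.term a :=
  antitone_nat_of_succ_le I.succ_le h

theorem mul_mem_of_le {a b c : ℕ} {x y : A} (hx : x ∈ I.term a) (hy : y ∈ I.term b)
    (h : c ≤ a + b) : x * y ∈ I.term c := I.anti h (I.mul_mem_term hx hy)

/-- The units `u` such that both `u` and `u⁻¹` are congruent to `1` modulo the `k`-th term. -/
def units (k : ℕ) : Subgroup Aˣ where
  carrier := {u | (u : A) - 1 ∈ I.term k ∧ ((u⁻¹ : Aˣ) : A) - 1 ∈ I.term k}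
  one_mem' := by simp
  mul_mem' := by
    have key : ∀ x y : A, x - 1 ∈ I.term k → y - 1 ∈ I.term k → x * y - 1 ∈ I.term k := by
      intro x y hx hy
      have : x * y - 1 = (x - 1) * (y - 1) + ((x - 1) + (y - 1)) := by noncomm_ring
      rw [this]
      exact add_mem (I.mul_mem_of_le hx hy (by omega)) (add_mem hx hy)
    intro u v hu hv
    refine ⟨by simpa using key _ _ hu.1 hv.1, ?_⟩
    rw [mul_inv_rev]
    simpa using key _ _ hv.2 hu.2
  inv_mem' := fun {u} hu => ⟨hu.2, by simpa using hu.1⟩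

variable {I}

theorem mem_zero_of_units {k : ℕ} {u : Aˣ} (hu : u ∈ I.units k) : (u : A) ∈ I.term 0 := by
  have := add_mem (I.anti (Nat.zero_le k) hu.1) I.one_mem_term
  simpa using this

theorem units_anti {a b : ℕ} (h : a ≤ b) : I.units b ≤ I.units a :=
  fun _ hu => ⟨I.anti h hu.1, I.anti h hu.2⟩

theorem mem_units_of_sub_one_mem {j k : ℕ} {u : Aˣ} (hu : u ∈ I.units j)
    (h : (u : A) - 1 ∈ I.term k) : u ∈ I.units k := by
  refine ⟨h, ?_⟩
  have h1 : ((u⁻¹ : Aˣ) : A) - 1 = -(((u⁻¹ : Aˣ) : A) * ((u : A) - 1)) := by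
    rw [mul_sub, Units.inv_mul, mul_one, neg_sub]
  rw [h1]
  exact neg_mem (I.mul_mem_of_le (mem_zero_of_units (inv_mem hu)) h (by omega))

theorem units_commutator_le (a b : ℕ) : ⁅I.units a, I.units b⁆ ≤ I.units (a + b) := by
  rw [Subgroup.commutator_le]
  intro u hu v hv
  have hu0 := units_anti (Nat.zero_le a) hu
  have hv0 := units_anti (Nat.zero_le b) hv
  refine mem_units_of_sub_one_mem (j := 0)
    (mul_mem (mul_mem (mul_mem hu0 hv0) (inv_mem hu0)) (inv_mem hv0)) ?_
  have h1 : ((u * v * u⁻¹ * v⁻¹ : Aˣ) : A) - 1 = (((u : A) - 1) * ((v : A) - 1) -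
      ((v : A) - 1) * ((u : A) - 1)) * (((u⁻¹ : Aˣ) : A) * ((v⁻¹ : Aˣ) : A)) := by
    have h2 : ((u : A) - 1) * ((v : A) - 1) - ((v : A) - 1) * ((u : A) - 1) =
        (u : A) * v - v * u := by noncomm_ring
    have h3 : (v : A) * u * (((u⁻¹ : Aˣ) : A) * ((v⁻¹ : Aˣ) : A)) = 1 := by
      rw [mul_assoc, Units.mul_inv_cancel_left, Units.mul_inv]
    rw [h2, sub_mul, h3]
    simp [mul_assoc]
  rw [commutatorElement_def, h1]
  refine I.mul_mem_of_le (b := 0) (sub_mem (I.mul_mem_term hu.1 hv.1) ?_)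
    (I.mul_mem_of_le (mem_zero_of_units (inv_mem hu)) (mem_zero_of_units (inv_mem hv)) le_rfl)
    le_rfl
  exact I.mul_mem_of_le hv.1 hu.1 (by omega)

/-- The quotient of two consecutive groups of unipotent units is torsion-free. -/
theorem mem_units_succ_of_pow {k n : ℕ} (hk : 1 ≤ k) (hn : n ≠ 0) {u : Aˣ} (hu : u ∈ I.units k)
    (h : u ^ n ∈ I.units (k + 1)) : u ∈ I.units (k + 1) := by
  have key : ∀ n : ℕ, (u : A) ^ n - 1 - (n : ℚ) • ((u : A) - 1) ∈ I.term (k + 1) := by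
    intro n
    induction n with
    | zero => simp
    | succ n ih =>
      have h1 : (u : A) ^ (n + 1) - 1 - ((n + 1 : ℕ) : ℚ) • ((u : A) - 1) =
          ((u : A) ^ n - 1) * ((u : A) - 1) + ((u : A) ^ n - 1 - (n : ℚ) • ((u : A) - 1)) := by
        rw [Nat.cast_succ, add_smul, one_smul, pow_succ]
        noncomm_ring
      rw [h1]
      have h2 : (u : A) ^ n - 1 ∈ I.term k := by
        simpa using (pow_mem hu n : u ^ n ∈ I.units k).1
      exact add_mem (I.mul_mem_of_le h2 hu.1 (by omega)) ih
  have h1 : (u : A) ^ n - 1 ∈ I.term (k + 1) := by simpa using h.1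
  have h2 := sub_mem h1 (key n)
  rw [sub_sub_cancel] at h2
  have h3 := (I.term (k + 1)).smul_mem ((n : ℚ)⁻¹) h2
  rw [inv_smul_smul₀ (Nat.cast_ne_zero.2 hn)] at h3
  exact mem_units_of_sub_one_mem hu h3

theorem exists_unit_one_add {d k : ℕ} (hd : I.term d = ⊥) (hk : 1 ≤ k) {x : A}
    (hx : x ∈ I.term k) : ∃ u : Aˣ, (u : A) = 1 + x ∧ u ∈ I.units k := by
  have hpow : ∀ i : ℕ, (-x) ^ i ∈ I.term i := by
    intro i
    induction i with
    | zero => simpa using I.one_mem_term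
    | succ i ih => rw [pow_succ]; exact I.mul_mem_term ih (I.anti hk (neg_mem hx))
  have h0 : (-x) ^ d = 0 := by
    have := hpow d
    rwa [hd, Submodule.mem_bot] at this
  have h1 := mul_neg_geom_sum (-x) d
  have h2 := geom_sum_mul_neg (-x) d
  rw [h0, sub_zero, sub_neg_eq_add] at h1 h2
  let u : Aˣ := ⟨1 + x, ∑ i ∈ Finset.range d, (-x) ^ i, h1, h2⟩
  refine ⟨u, rfl, ?_⟩
  refine mem_units_of_sub_one_mem (j := 0) ⟨?_, ?_⟩ ?_
  · simpa [u] using I.anti (Nat.zero_le k) hx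
  · have h3 : ∑ i ∈ Finset.range d, (-x) ^ i ∈ I.term 0 :=
      sum_mem fun i _ => I.anti (Nat.zero_le i) (hpow i)
    exact sub_mem h3 I.one_mem_term
  · simpa [u] using hx

/-- A perturbation of degree `k` of a map to unipotent units changes the value of a word, modulo
degree `k + 1`, by the linear extension of the perturbation. -/
theorem lift_perturb {X : Type*} {θ θ' : X → Aˣ} {k : ℕ} (φ : (X →₀ ℚ) →ₗ[ℚ] I.term k)
    (hθ : ∀ e, θ e ∈ I.units 1) (hθ' : ∀ e, θ' e ∈ I.units 1)
    (h : ∀ e, (θ' e : A) - θ e - φ (Finsupp.single e 1) ∈ I.term (k + 1)) (y : FreeGroup X) :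
    (FreeGroup.lift θ' y : A) - (FreeGroup.lift θ y : Aˣ) - φ (cls y) ∈ I.term (k + 1) := by
  have hmem : ∀ (θ : X → Aˣ), (∀ e, θ e ∈ I.units 1) → ∀ y, FreeGroup.lift θ y ∈ I.units 1 :=
    fun θ hθ y => FreeGroup.range_lift_le (by rintro _ ⟨e, rfl⟩; exact hθ e) ⟨y, rfl⟩
  induction y using FreeGroup.induction_on with
  | C1 => simp
  | of e => simpa using h e
  | inv_of e ih =>
    rw [FreeGroup.lift_apply_of, FreeGroup.lift_apply_of] at ih
    rw [map_inv, map_inv, FreeGroup.lift_apply_of, FreeGroup.lift_apply_of, cls_inv, map_neg]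
    set u := θ e
    set v := θ' e
    set c : A := (φ (cls (FreeGroup.of e)) : A) with hc
    have hcm : c ∈ I.term k := (φ (cls (FreeGroup.of e))).2
    have hu := inv_mem (hθ e)
    have hv := inv_mem (hθ' e)
    have h1 : ((v⁻¹ : Aˣ) : A) - (u⁻¹ : Aˣ) - ((-φ (cls (FreeGroup.of e)) : I.term k) : A) =
        -(((v⁻¹ : Aˣ) : A) * (((v : A) - u - c) * ((u⁻¹ : Aˣ) : A))) -
          ((((v⁻¹ : Aˣ) : A) - 1) * (c * ((u⁻¹ : Aˣ) : A)) + c * (((u⁻¹ : Aˣ) : A) - 1)) := by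
      have h2 : ((v⁻¹ : Aˣ) : A) * ((v : A) * ((u⁻¹ : Aˣ) : A)) = (u⁻¹ : Aˣ) := by simp
      have h3 : ((v⁻¹ : Aˣ) : A) * ((u : A) * ((u⁻¹ : Aˣ) : A)) = (v⁻¹ : Aˣ) := by simp
      simp only [sub_mul, mul_sub, one_mul, mul_one, h2, h3]
      push_cast
      rw [← hc]
      abel
    rw [h1]
    exact sub_mem (neg_mem (I.mul_mem_of_le (mem_zero_of_units hv)
      (I.mul_mem_of_le ih (mem_zero_of_units hu) le_rfl) (by omega)))
      (add_mem (I.mul_mem_of_le hv.1 (I.mul_mem_of_le hcm (mem_zero_of_units hu) le_rfl) (by omega))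
        (I.mul_mem_of_le hcm hu.1 (by omega)))
  | mul x y hx hy =>
    rw [map_mul, map_mul, cls_mul, map_add]
    have hux := hmem θ hθ x
    have huy := hmem θ hθ y
    have hvy := hmem θ' hθ' y
    set u := FreeGroup.lift θ x
    set u' := FreeGroup.lift θ y
    set v := FreeGroup.lift θ' x
    set v' := FreeGroup.lift θ' y
    set c : A := (φ (cls x) : A) with hc
    set c' : A := (φ (cls y) : A) with hc'
    have hcm : c ∈ I.term k := (φ (cls x)).2
    have hcm' : c' ∈ I.term k := (φ (cls y)).2
    have h1 : ((v * v' : Aˣ) : A) - (u * u' : Aˣ) - ((φ (cls x) + φ (cls y) : I.term k) : A) =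
        ((v : A) - u - c) * v' + (u : A) * ((v' : A) - u' - c') +
          (((u : A) - 1) * c' + c * ((v' : A) - 1)) := by
      push_cast
      rw [← hc, ← hc']
      noncomm_ring
    rw [h1]
    exact add_mem (add_mem (I.mul_mem_of_le hx (mem_zero_of_units hvy) le_rfl)
      (I.mul_mem_of_le (mem_zero_of_units hux) hy (by omega)))
      (add_mem (I.mul_mem_of_le hux.1 hcm' (by omega)) (I.mul_mem_of_le hcm hvy.1 (by omega)))

end Filtration

/-! ### Extension over the translates of a closed path -/

section Extension

variable {Γ α : Type*} [Group Γ]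

/-- Modulo the elements supported on a saturated set `Z`, the translates of `m` that are not
supported on `Z` are linearly independent. -/
theorem Saturated.exists_linearMap {m : Γ × α →₀ ℚ} {Z : Finset (Γ × α)} (hZ : Saturated m Z)
    {V : Type*} [AddCommGroup V] [Module ℚ V] (b : Γ → V)
    (hb : ∀ g, (∀ e ∈ m.support, shift g e ∈ Z) → b g = 0) :
    ∃ φ : (Γ × α →₀ ℚ) →ₗ[ℚ] V, (∀ e ∈ Z, φ (Finsupp.single e 1) = 0) ∧
      ∀ g, φ (m.mapDomain (shift g)) = b g := by
  classical
  let ι := {g : Γ // ¬ ∀ e ∈ m.support, shift g e ∈ Z}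
  let C : Submodule ℚ (Γ × α →₀ ℚ) := Finsupp.supported ℚ ℚ (Z : Set (Γ × α))
  let f : (ι →₀ ℚ) →ₗ[ℚ] (Γ × α →₀ ℚ) ⧸ C :=
    C.mkQ ∘ₗ Finsupp.linearCombination ℚ fun g : ι => m.mapDomain (shift g.1)
  have hf : LinearMap.ker f = ⊥ := by
    rw [LinearMap.ker_eq_bot']
    intro p hp
    have h1 : conv (p.mapDomain Subtype.val) m =
        Finsupp.linearCombination ℚ (fun g : ι => m.mapDomain (shift g.1)) p := by
      rw [conv, Finsupp.sum_mapDomain_index (h := fun g c => c • m.mapDomain (shift g)) (fun _ => zero_smul _ _)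
        (fun _ _ _ => add_smul _ _ _)]
      rfl
    have h2 : conv (p.mapDomain Subtype.val) m ∈ C := by
      rw [h1]; exact (Submodule.Quotient.mk_eq_zero C).1 hp
    have h3 := hZ (p.mapDomain Subtype.val) fun e he =>
      (Finsupp.mem_supported _ _).1 h2 (Finsupp.mem_support_iff.2 he)
    ext g
    by_contra hg
    refine g.2 (h3 g.1 (Finsupp.mem_support_iff.2 ?_))
    rwa [Finsupp.mapDomain_apply Subtype.val_injective]
  obtain ⟨r, hr⟩ := LinearMap.exists_leftInverse_of_injective f hf
  refine ⟨Finsupp.linearCombination ℚ (fun g : ι => b g.1) ∘ₗ r ∘ₗ C.mkQ, fun e he => ?_,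
    fun g => ?_⟩
  · have h1 : C.mkQ (Finsupp.single e 1) = 0 :=
      (Submodule.Quotient.mk_eq_zero C).2 (Finsupp.single_mem_supported ℚ 1 he)
    simp [h1]
  · by_cases hg : ∀ e ∈ m.support, shift g e ∈ Z
    · have h1 : C.mkQ (m.mapDomain (shift g)) = 0 := by
        refine (Submodule.Quotient.mk_eq_zero C).2 ((Finsupp.mem_supported _ _).2 ?_)
        intro e he
        obtain ⟨e', he', rfl⟩ := Finset.mem_image.1 (Finsupp.mapDomain_support he)
        exact hg e' he'
      rw [hb g hg]
      simp [h1]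
    · have h1 : C.mkQ (m.mapDomain (shift g)) = f (Finsupp.single ⟨g, hg⟩ 1) := by simp [f]
      have h2 := LinearMap.congr_fun hr (Finsupp.single ⟨g, hg⟩ 1)
      simp only [LinearMap.comp_apply, LinearMap.id_apply] at h2 ⊢
      rw [h1, h2]
      simp

/-- A map from the edges to unipotent units that kills the translates of the closed path `l`
supported on the saturated set `Z` agrees on `Z` with a map that kills all translates. It is built
modulo the terms of the filtration one after the other; each step is a linear problem. -/
theorem exists_extension {A : Type*} [Ring A] [Algebra ℚ A] {I : Filtration A} {d : ℕ}
    (hd : I.term d = ⊥) {l : List ((Γ × α) × Bool)} (hl : (l.map Prod.fst).Nodup)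
    {Z : Finset (Γ × α)} (hZ : Saturated (cls (FreeGroup.mk l)) Z) {θ₀ : Γ × α → Aˣ}
    (hθ₀ : ∀ e, θ₀ e ∈ I.units 1)
    (hP : ∀ g, (∀ e ∈ l.map Prod.fst, shift g e ∈ Z) →
      FreeGroup.lift θ₀ (FreeGroup.map (shift g) (FreeGroup.mk l)) = 1) :
    ∃ θ : Γ × α → Aˣ, (∀ e, θ e ∈ I.units 1) ∧ (∀ e ∈ Z, θ e = θ₀ e) ∧
      ∀ g, FreeGroup.lift θ (FreeGroup.map (shift g) (FreeGroup.mk l)) = 1 := by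
  classical
  have step : ∀ k, ∃ θ : Γ × α → Aˣ, (∀ e, θ e ∈ I.units 1) ∧ (∀ e ∈ Z, θ e = θ₀ e) ∧
      ∀ g, FreeGroup.lift θ (FreeGroup.map (shift g) (FreeGroup.mk l)) ∈ I.units (k + 1) := by
    intro k
    induction k with
    | zero =>
      exact ⟨θ₀, hθ₀, fun _ _ => rfl, fun g =>
        FreeGroup.range_lift_le (by rintro _ ⟨e, rfl⟩; exact hθ₀ e) ⟨_, rfl⟩⟩
    | succ k ih =>
      obtain ⟨θ, hθ, hθZ, hθl⟩ := ih
      let b : Γ → I.term (k + 1) := fun g => -⟨_, (hθl g).1⟩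
      obtain ⟨φ, hφZ, hφ⟩ := hZ.exists_linearMap b (by
        intro g hg
        have hg' : ∀ e ∈ l.map Prod.fst, shift g e ∈ Z := fun e he =>
          hg e ((mem_support_cls_mk hl).2 he)
        have h1 : FreeGroup.lift θ (FreeGroup.map (shift g) (FreeGroup.mk l)) = 1 := by
          rw [← hP g hg', mk_map_shift]
          refine lift_mk_congr fun e he => hθZ e ?_
          rw [List.map_map] at he
          obtain ⟨x, hx, rfl⟩ := List.mem_map.1 he
          exact hg' x.1 (List.mem_map_of_mem hx)
        refine neg_eq_zero.2 (Subtype.ext ?_)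
        change ((FreeGroup.lift θ (FreeGroup.map (shift g) (FreeGroup.mk l)) : Aˣ) : A) - 1 = 0
        rw [h1, Units.val_one, sub_self])
      have hv : ∀ e, ∃ v : Aˣ, (v : A) = 1 + φ (Finsupp.single e 1) ∧ v ∈ I.units (k + 1) :=
        fun e => Filtration.exists_unit_one_add hd (by omega) (φ (Finsupp.single e 1)).2
      choose v hv hvm using hv
      have hθ' : ∀ e, θ e * v e ∈ I.units 1 := fun e =>
        mul_mem (hθ e) (Filtration.units_anti (by omega) (hvm e))
      refine ⟨fun e => θ e * v e, hθ', fun e he => ?_, fun g => ?_⟩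
      · have : v e = 1 := by
          ext; rw [hv, hφZ e he]; simp
        change θ e * v e = θ₀ e
        rw [this, mul_one, hθZ e he]
      · have h1 := Filtration.lift_perturb (θ := θ) (θ' := fun e => θ e * v e) φ hθ hθ'
          (fun e => by
            have h2 : ((θ e * v e : Aˣ) : A) - θ e - φ (Finsupp.single e 1) =
                ((θ e : A) - 1) * φ (Finsupp.single e 1) := by
              push_cast; rw [hv]; noncomm_ring
            rw [h2]
            exact I.mul_mem_of_le (hθ e).1 (φ (Finsupp.single e 1)).2 (by omega))
          (FreeGroup.map (shift g) (FreeGroup.mk l))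
        rw [cls_map, hφ] at h1
        refine Filtration.mem_units_of_sub_one_mem (j := 1)
          (FreeGroup.range_lift_le (by rintro _ ⟨e, rfl⟩; exact hθ' e) ⟨_, rfl⟩) ?_
        simpa [b] using h1
  obtain ⟨θ, hθ, hθZ, hθl⟩ := step d
  refine ⟨θ, hθ, hθZ, fun g => ?_⟩
  have h1 := I.anti (Nat.le_succ d) (hθl g).1
  rw [hd, Submodule.mem_bot, sub_eq_zero] at h1
  exact Units.ext h1

end Extension

/-! ### Free groups are residually unipotent -/

/-- An element of a free group is a product of powers of generators with nonzero exponents, where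
neighbouring generators differ. -/
theorem exists_syllables {X : Type*} (y : FreeGroup X) :
    ∃ l : List (X × ℤ), (∀ p ∈ l, p.2 ≠ 0) ∧ l.IsChain (fun p q => p.1 ≠ q.1) ∧
      y = (l.map fun p => FreeGroup.of p.1 ^ p.2).prod := by
  classical
  have step : ∀ (a : X) (k : ℤ) (l : List (X × ℤ)), k ≠ 0 → (∀ p ∈ l, p.2 ≠ 0) →
      l.IsChain (fun p q => p.1 ≠ q.1) → ∃ l' : List (X × ℤ), (∀ p ∈ l', p.2 ≠ 0) ∧
        l'.IsChain (fun p q => p.1 ≠ q.1) ∧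
          FreeGroup.of a ^ k * (l.map fun p => FreeGroup.of p.1 ^ p.2).prod =
            (l'.map fun p => FreeGroup.of p.1 ^ p.2).prod := by
    intro a k l hk hl hc
    cases l with
    | nil => exact ⟨[(a, k)], by simpa using hk, by simp, by simp⟩
    | cons q t =>
      obtain ⟨b, m⟩ := q
      by_cases hab : a = b
      · subst hab
        by_cases hkm : k + m = 0
        · refine ⟨t, fun p hp => hl p (List.mem_cons_of_mem _ hp), hc.tail, ?_⟩
          rw [List.map_cons, List.prod_cons, ← mul_assoc, ← zpow_add, hkm, zpow_zero, one_mul]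
        · refine ⟨(a, k + m) :: t, ?_, ?_, ?_⟩
          · intro p hp
            rcases List.mem_cons.1 hp with rfl | hp
            · exact hkm
            · exact hl p (List.mem_cons_of_mem _ hp)
          · cases t with
            | nil => simp
            | cons r t =>
              rw [List.isChain_cons_cons] at hc ⊢
              exact hc
          · rw [List.map_cons, List.prod_cons, ← mul_assoc, ← zpow_add, List.map_cons,
              List.prod_cons]
      · refine ⟨(a, k) :: (b, m) :: t, ?_, ?_, by simp⟩
        · intro p hp
          rcases List.mem_cons.1 hp with rfl | hp
          · exact hk
          · exact hl p hp
        · rw [List.isChain_cons_cons]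
          exact ⟨hab, hc⟩
  rw [← FreeGroup.mk_toWord (x := y)]
  induction y.toWord with
  | nil => exact ⟨[], by simp, by simp, by simp [FreeGroup.one_eq_mk]⟩
  | cons x w ih =>
    obtain ⟨l, hl, hc, h⟩ := ih
    obtain ⟨a, _ | _⟩ := x
    · obtain ⟨l', hl', hc', h'⟩ := step a (-1) l (by norm_num) hl hc
      exact ⟨l', hl', hc', by rw [mk_cons_false, h, ← h', zpow_neg_one]⟩
    · obtain ⟨l', hl', hc', h'⟩ := step a 1 l one_ne_zero hl hc
      exact ⟨l', hl', hc', by rw [mk_cons_true, h, ← h', zpow_one]⟩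

/-- The filtration of the algebra of matrices whose `k`-th term consists of the matrices that
vanish below the `k`-th diagonal above the main one. -/
def upperFiltration (n : ℕ) : Filtration (Matrix (Fin n) (Fin n) ℚ) where
  term k :=
    { carrier := {M | ∀ i j : Fin n, (j : ℕ) < i + k → M i j = 0}
      add_mem' := fun hM hN i j h => by rw [Matrix.add_apply, hM i j h, hN i j h, add_zero]
      zero_mem' := fun _ _ _ => rfl
      smul_mem' := fun c M hM i j h => by rw [Matrix.smul_apply, hM i j h, smul_zero] }
  one_mem_term := fun i j h => Matrix.one_apply_ne (by rintro rfl; omega)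
  succ_le := fun k M hM i j h => hM i j (by omega)
  mul_mem_term := fun {a b M N} hM hN i j h => by
    rw [Matrix.mul_apply]
    refine Finset.sum_eq_zero fun l _ => ?_
    by_cases hl : (l : ℕ) < i + a
    · rw [hM i l hl, zero_mul]
    · rw [hN l j (by omega), mul_zero]

theorem upperFiltration_term_self (n : ℕ) : (upperFiltration n).term n = ⊥ := by
  rw [eq_bot_iff]
  intro M hM
  rw [Submodule.mem_bot]
  ext i j
  exact hM i j (by omega)

/-- Free groups are residually unipotent: for `y = a₁ ^ k₁ ⋯ aₙ ^ kₙ` with `aᵢ ≠ aᵢ₊₁`, send `a` to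
`1 + ∑ E i (i + 1)`, the sum over all `i` with `aᵢ = a`. The square of this sum is `0`, and the
corner entry of the image of `y` is `k₁ ⋯ kₙ`. -/
theorem exists_unipotent_ne_one {X : Type*} {y : FreeGroup X} (hy : y ≠ 1) :
    ∃ (n : ℕ) (θ : X → (Matrix (Fin n) (Fin n) ℚ)ˣ),
      (∀ e, θ e ∈ (upperFiltration n).units 1) ∧ FreeGroup.lift θ y ≠ 1 := by
  classical
  obtain ⟨l, hl, hc, rfl⟩ := exists_syllables y
  have hl0 : 0 < l.length := by
    rw [List.length_pos_iff]
    rintro rfl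
    exact hy (by simp)
  set n := l.length with hn
  let N : X → Matrix (Fin (n + 1)) (Fin (n + 1)) ℚ := fun a i j =>
    if (j : ℕ) = i + 1 ∧ (l[(i : ℕ)]?).map Prod.fst = some a then 1 else 0
  have hN1 : ∀ a, N a ∈ (upperFiltration (n + 1)).term 1 := fun a i j h =>
    if_neg (by rintro ⟨h1, -⟩; omega)
  have hNN : ∀ a, N a * N a = 0 := by
    intro a
    ext i j
    rw [Matrix.mul_apply]
    refine Finset.sum_eq_zero fun k _ => ?_
    by_contra hne
    have h1 : (k : ℕ) = i + 1 ∧ (l[(i : ℕ)]?).map Prod.fst = some a := by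
      by_contra h; exact hne (by simp only [N]; rw [if_neg h, zero_mul])
    have h2 : (j : ℕ) = k + 1 ∧ (l[(k : ℕ)]?).map Prod.fst = some a := by
      by_contra h; exact hne (by simp only [N]; rw [if_neg h, mul_zero])
    have hk : (i : ℕ) + 1 < l.length := by omega
    have h3 := List.isChain_iff_getElem.1 hc i hk
    rw [List.getElem?_eq_getElem (by omega), Option.map_some, Option.some_inj] at h1
    simp only [h1.1] at h2
    rw [List.getElem?_eq_getElem hk, Option.map_some, Option.some_inj] at h2
    exact h3 (h1.2.trans h2.2.symm)
  let u : X → ℤ → (Matrix (Fin (n + 1)) (Fin (n + 1)) ℚ)ˣ := fun a k =>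
    ⟨1 + (k : ℚ) • N a, 1 - (k : ℚ) • N a, by
      simp [mul_sub, add_mul, hNN], by simp [mul_add, sub_mul, hNN]⟩
  have hu : ∀ a (k : ℤ), u a 1 ^ k = u a k := by
    intro a k
    have hmul : ∀ j k, u a j * u a k = u a (j + k) := by
      intro j k
      ext1
      simp only [u, Units.val_mul]
      push_cast
      simp only [mul_add, add_mul, mul_one, one_mul, smul_mul_smul_comm, hNN, smul_zero, add_smul]
      abel
    have h0 : u a 0 = 1 := by ext1; simp [u]
    let f : Multiplicative ℤ →* (Matrix (Fin (n + 1)) (Fin (n + 1)) ℚ)ˣ :=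
      { toFun := fun k => u a k.toAdd
        map_one' := h0
        map_mul' := fun j k => (hmul _ _).symm }
    have h1 : f (Multiplicative.ofAdd 1 ^ k) = f (Multiplicative.ofAdd 1) ^ k := map_zpow f _ _
    rw [← ofAdd_zsmul, smul_eq_mul, mul_one] at h1
    exact h1.symm
  refine ⟨n + 1, fun a => u a 1, fun a => ?_, fun h => ?_⟩
  · refine ⟨?_, ?_⟩
    · simpa [u] using hN1 a
    · have : ((u a 1)⁻¹ : (Matrix (Fin (n + 1)) (Fin (n + 1)) ℚ)ˣ).1 - 1 = -N a := by
        change 1 - ((1 : ℤ) : ℚ) • N a - 1 = -N a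
        simp
      rw [this]
      exact neg_mem (hN1 a)
  -- the last column of the product of the images of the syllables in a suffix `l₂` of `l`
  have key : ∀ l₁ l₂ : List (X × ℤ), l = l₁ ++ l₂ → ∀ i : Fin (n + 1),
      ((i : ℕ) < l₁.length → (l₂.map fun p => (u p.1 p.2).1).prod i (Fin.last n) = 0) ∧
      ((i : ℕ) = l₁.length → (l₂.map fun p => (u p.1 p.2).1).prod i (Fin.last n) ≠ 0) := by
    intro l₁ l₂
    induction l₂ generalizing l₁ with
    | nil =>
      intro h i
      have hlen : l₁.length = n := by rw [hn, h]; simp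
      refine ⟨fun hi => ?_, fun hi => ?_⟩
      · rw [List.map_nil, List.prod_nil, Matrix.one_apply_ne]
        intro hil
        rw [hil, Fin.val_last] at hi
        omega
      · have : i = Fin.last n := Fin.ext (by rw [Fin.val_last]; omega)
        rw [List.map_nil, List.prod_nil, this, Matrix.one_apply_eq]
        exact one_ne_zero
    | cons p t ih =>
      intro h i
      have hlen : l₁.length + (t.length + 1) = n := by rw [hn, h]; simp
      have ih' := ih (l₁ ++ [p]) (by rw [h]; simp)
      rw [List.length_append, List.length_singleton] at ih'
      set M := (t.map fun p => (u p.1 p.2).1).prod with hM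
      have hprod : ((p :: t).map fun p => (u p.1 p.2).1).prod i (Fin.last n) =
          M i (Fin.last n) + p.2 * ∑ j, N p.1 i j * M j (Fin.last n) := by
        rw [List.map_cons, List.prod_cons, ← hM]
        change ((1 + (p.2 : ℚ) • N p.1) * M) i (Fin.last n) = _
        rw [add_mul, one_mul, Matrix.add_apply, smul_mul_assoc, Matrix.smul_apply, smul_eq_mul,
          Matrix.mul_apply]
      rw [hprod]
      refine ⟨fun hi => ?_, fun hi => ?_⟩
      · rw [(ih' i).1 (by omega), Finset.sum_eq_zero, mul_zero, add_zero]
        intro j _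
        by_cases hj : (j : ℕ) = i + 1
        · rw [(ih' j).1 (by omega), mul_zero]
        · simp only [N]; rw [if_neg (fun h => hj h.1), zero_mul]
      · have hi1 : (i : ℕ) + 1 < n + 1 := by omega
        rw [(ih' i).1 (by omega), zero_add, Finset.sum_eq_single (⟨i + 1, hi1⟩ : Fin (n + 1))]
        · have h1 : N p.1 i ⟨i + 1, hi1⟩ = 1 := by
            refine if_pos ⟨rfl, ?_⟩
            rw [hi, h]; simp
          rw [h1, one_mul]
          refine mul_ne_zero ?_ ((ih' _).2 (by simp [hi]))
          exact_mod_cast hl p (by rw [h]; simp)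
        · intro j _ hj
          simp only [N]
          rw [if_neg (fun h => hj (Fin.ext h.1)), zero_mul]
        · simp
  refine (key [] l rfl 0).2 rfl ?_
  have h1 : (l.map fun p => (u p.1 p.2).1).prod =
      (FreeGroup.lift (fun a => u a 1) (l.map fun p => FreeGroup.of p.1 ^ p.2).prod).1 := by
    rw [map_list_prod, List.map_map, ← Units.coeHom_apply, map_list_prod, List.map_map]
    congr 1
    refine List.map_congr_left fun p _ => ?_
    change (u p.1 p.2).1 = (FreeGroup.lift (fun a => u a 1) (FreeGroup.of p.1 ^ p.2)).1
    rw [map_zpow, FreeGroup.lift_apply_of, hu]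
  rw [h1, h, Units.val_one, Matrix.one_apply_ne]
  intro h0
  have := congrArg Fin.val h0
  simp at this
  omega

/-! ### The rational derived series of a quotient -/

section Series

variable {G : Type*} [Group G]

/-- The preimage in `G` of the `n`-th term of the rational derived series of `G ⧸ R`. -/
def quotientSeries (R : Subgroup G) [R.Normal] (n : ℕ) : Subgroup G :=
  (rationalDerivedSeries (G ⧸ R) n).comap (QuotientGroup.mk' R)

theorem rationalDerivedSubgroup_normal (H : Subgroup G) [hH : H.Normal] :
    (rationalDerivedSubgroup H).Normal := by
  refine ⟨fun x hx g => ⟨hH.conj_mem x hx.1 g, ?_⟩⟩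
  obtain ⟨k, hk, hxk⟩ := hx.2
  exact ⟨k, hk, by
    rw [conj_zpow]; exact (inferInstance : (⁅H, H⁆).Normal).conj_mem _ hxk g⟩

instance rationalDerivedSeries_normal (n : ℕ) : (rationalDerivedSeries G n).Normal := by
  induction n with
  | zero => exact (inferInstance : (⊤ : Subgroup G).Normal)
  | succ n ih => exact rationalDerivedSubgroup_normal _

instance rationalDerivedOmega_normal : (rationalDerivedOmega G).Normal :=
  Subgroup.normal_iInf_normal fun _ => inferInstance

variable (R : Subgroup G) [R.Normal]

instance quotientSeries_normal (n : ℕ) : (quotientSeries R n).Normal :=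
  Subgroup.normal_comap _

theorem quotientSeries_zero : quotientSeries R 0 = ⊤ := Subgroup.comap_top _

theorem mem_quotientSeries_succ {n : ℕ} {x : G} : x ∈ quotientSeries R (n + 1) ↔
    x ∈ quotientSeries R n ∧
      ∃ k : ℤ, k ≠ 0 ∧ x ^ k ∈ ⁅quotientSeries R n, quotientSeries R n⁆ ⊔ R := by
  have h1 : ⁅rationalDerivedSeries (G ⧸ R) n, rationalDerivedSeries (G ⧸ R) n⁆ =
      (⁅quotientSeries R n, quotientSeries R n⁆).map (QuotientGroup.mk' R) := by
    rw [Subgroup.map_commutator, quotientSeries,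
      Subgroup.map_comap_eq_self_of_surjective (QuotientGroup.mk'_surjective R)]
  have h2 : ∀ y : G, QuotientGroup.mk' R y ∈
      ⁅rationalDerivedSeries (G ⧸ R) n, rationalDerivedSeries (G ⧸ R) n⁆ ↔
        y ∈ ⁅quotientSeries R n, quotientSeries R n⁆ ⊔ R := by
    intro y
    rw [h1, ← Subgroup.mem_comap, Subgroup.comap_map_eq, QuotientGroup.ker_mk']
  refine and_congr Iff.rfl (exists_congr fun k => and_congr Iff.rfl ?_)
  rw [← map_zpow, h2]

theorem le_quotientSeries (n : ℕ) : R ≤ quotientSeries R n := by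
  have := (QuotientGroup.mk' R).ker_le_comap (rationalDerivedSeries (G ⧸ R) n)
  rwa [QuotientGroup.ker_mk'] at this

theorem quotientSeries_succ_le (n : ℕ) : quotientSeries R (n + 1) ≤ quotientSeries R n :=
  fun _ hx => ((mem_quotientSeries_succ R).1 hx).1

theorem quotientSeries_anti : Antitone (quotientSeries R) :=
  antitone_nat_of_succ_le (quotientSeries_succ_le R)

theorem commutator_le_quotientSeries_succ (n : ℕ) :
    ⁅quotientSeries R n, quotientSeries R n⁆ ≤ quotientSeries R (n + 1) := fun x hx =>
  (mem_quotientSeries_succ R).2 ⟨Subgroup.commutator_le_left _ _ hx, 1, one_ne_zero,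
    by rw [zpow_one]; exact Subgroup.mem_sup_left hx⟩

theorem mem_quotientSeries_succ_of_zpow {n : ℕ} {x : G} (hx : x ∈ quotientSeries R n) {k : ℤ}
    (hk : k ≠ 0) (h : x ^ k ∈ quotientSeries R (n + 1)) : x ∈ quotientSeries R (n + 1) := by
  obtain ⟨-, j, hj, hxj⟩ := (mem_quotientSeries_succ R).1 h
  exact (mem_quotientSeries_succ R).2 ⟨hx, k * j, mul_ne_zero hk hj, by rwa [zpow_mul]⟩

/-- The quotients by the terms of the rational derived series are iterated extensions of torsion-free
abelian groups. -/
theorem locallyIndicable_quotientSeries (n : ℕ) : LocallyIndicable (G ⧸ quotientSeries R n) := by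
  induction n with
  | zero =>
    have : Subsingleton (G ⧸ quotientSeries R 0) :=
      QuotientGroup.subsingleton_iff.2 (quotientSeries_zero R)
    exact LocallyIndicable.of_subsingleton
  | succ n ih =>
    let f : G ⧸ quotientSeries R (n + 1) →* G ⧸ quotientSeries R n :=
      QuotientGroup.map _ _ (MonoidHom.id G) (quotientSeries_succ_le R n)
    have hf : ∀ x : G, (x : G ⧸ quotientSeries R (n + 1)) ∈ f.ker → x ∈ quotientSeries R n :=
      fun x hx => (QuotientGroup.eq_one_iff x).1 hx
    refine ih.of_hom f (fun x => ?_) fun x => ?_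
    · induction x using QuotientGroup.induction_on with | _ x =>
      intro hx y
      induction y using QuotientGroup.induction_on with | _ y =>
      intro hy
      rw [← QuotientGroup.mk_mul, ← QuotientGroup.mk_mul, QuotientGroup.eq]
      have := commutator_le_quotientSeries_succ R n (Subgroup.commutator_mem_commutator
        (inv_mem (hf y hy)) (inv_mem (hf x hx)))
      rw [commutatorElement_def] at this
      simpa [mul_assoc] using this
    · induction x using QuotientGroup.induction_on with | _ x =>
      intro hx k hk hxk
      rw [← QuotientGroup.mk_zpow, QuotientGroup.eq_one_iff] at hxk
      exact (QuotientGroup.eq_one_iff x).2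
        (mem_quotientSeries_succ_of_zpow R (hf x hx) hk hxk)

end Series

/-! ### One-relator groups whose relator lifts to a simple closed path -/

section Simple

variable {α Γ : Type*} [Group Γ] (π : FreeGroup α →* Γ)

/-- The elements of the kernel of `π` whose path at `1` has its value under `θ` in `U`. -/
def evalSubgroup {A : Type*} [Group A] (θ : Γ × α → A) (U : Subgroup A) :
    Subgroup (FreeGroup α) where
  carrier := {z | π z = 1 ∧ FreeGroup.lift θ (path π 1 z) ∈ U}
  one_mem' := by simp
  mul_mem' := fun {x y} hx hy => ⟨by rw [map_mul, hx.1, hy.1, one_mul], by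
    rw [path_mul, hx.1, mul_one, map_mul]; exact mul_mem hx.2 hy.2⟩
  inv_mem' := fun {x} hx => ⟨by rw [map_inv, hx.1, inv_one], by
    rw [path_inv, hx.1, inv_one, mul_one, map_inv]; exact inv_mem hx.2⟩

theorem normalClosure_le_evalSubgroup {A : Type*} [Group A] {θ : Γ × α → A} (U : Subgroup A)
    {c : FreeGroup α} (hc : π c = 1) (h : ∀ g, FreeGroup.lift θ (path π g c) = 1) :
    Subgroup.normalClosure {c} ≤ evalSubgroup π θ U := by
  rw [Subgroup.normalClosure, Subgroup.closure_le]
  intro z hz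
  obtain ⟨c', hc', hcz⟩ := Group.mem_conjugatesOfSet_iff.1 hz
  rw [Set.mem_singleton_iff] at hc'
  subst hc'
  obtain ⟨y, rfl⟩ := isConj_iff.1 hcz
  refine ⟨by simp [hc], ?_⟩
  rw [path_conj π y hc, one_mul, map_mul, map_mul, h, mul_one, map_inv, mul_inv_cancel]
  exact one_mem U

/-- A homomorphism of the free group on the edges to unipotent units that kills the translates of
the path of `c` maps `quotientSeries ⟨⟨c⟩⟩ (n + j)` to the `j + 1`-st term of the filtration. -/
theorem lift_path_mem_units {c : FreeGroup α} {n : ℕ}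
    (hker : π.ker = quotientSeries (Subgroup.normalClosure {c}) n) {A : Type*} [Ring A]
    [Algebra ℚ A] {I : Filtration A} {θ : Γ × α → Aˣ} (hθ : ∀ e, θ e ∈ I.units 1)
    (h : ∀ g, FreeGroup.lift θ (path π g c) = 1) (j : ℕ) :
    quotientSeries (Subgroup.normalClosure {c}) (n + j) ≤
      evalSubgroup π θ (I.units (j + 1)) := by
  have hker' : ∀ {j x}, x ∈ quotientSeries (Subgroup.normalClosure {c}) (n + j) →
      π x = 1 := fun hx => by
    rw [← MonoidHom.mem_ker, hker]
    exact quotientSeries_anti _ (Nat.le_add_right n _) hx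
  induction j with
  | zero =>
    exact fun x hx => ⟨hker' hx,
      FreeGroup.range_lift_le (by rintro _ ⟨e, rfl⟩; exact hθ e) ⟨_, rfl⟩⟩
  | succ j ih =>
    intro x hx
    refine ⟨hker' hx, ?_⟩
    obtain ⟨hx', k, hk, hxk⟩ := (mem_quotientSeries_succ _).1 hx
    have h1 : ⁅quotientSeries (Subgroup.normalClosure {c}) (n + j),
        quotientSeries (Subgroup.normalClosure {c}) (n + j)⁆ ≤
          evalSubgroup π θ (I.units (j + 1 + 1)) := by
      rw [Subgroup.commutator_le]
      intro y hy z hz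
      obtain ⟨hy1, hy2⟩ := ih hy
      obtain ⟨hz1, hz2⟩ := ih hz
      refine ⟨by rw [map_commutatorElement, hy1, hz1, commutatorElement_self], ?_⟩
      have h2 := Filtration.units_commutator_le _ _
        (Subgroup.commutator_mem_commutator hy2 hz2)
      refine Filtration.units_anti (by omega) ?_ (b := j + 1 + (j + 1))
      convert h2 using 1
      rw [commutatorElement_def, commutatorElement_def]
      simp only [path_mul, path_inv, map_mul, map_inv, hy1, hz1, inv_one, mul_one]
    have h2 : Subgroup.normalClosure {c} ≤
        evalSubgroup π θ (I.units (j + 1 + 1)) :=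
      normalClosure_le_evalSubgroup _ _ (by
        rw [← MonoidHom.mem_ker, hker]
        exact le_quotientSeries _ n (Subgroup.subset_normalClosure rfl)) h
    have h3 : x ^ k.natAbs ∈ evalSubgroup π θ (I.units (j + 1 + 1)) := by
      have h4 := sup_le h1 h2 hxk
      rcases Int.natAbs_eq k with hk' | hk'
      · rw [hk', zpow_natCast] at h4; exact h4
      · rw [hk', zpow_neg, zpow_natCast] at h4; exact inv_mem_iff.1 h4
    have h5 : ∀ m : ℕ, FreeGroup.lift θ (path π 1 (x ^ m)) =
        FreeGroup.lift θ (path π 1 x) ^ m := by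
      intro m
      induction m with
      | zero => simp
      | succ m ih =>
        rw [pow_succ, path_mul, map_pow, hker' hx, one_pow, mul_one, map_mul, ih, pow_succ]
    have h6 := h3.2
    rw [h5] at h6
    exact Filtration.mem_units_succ_of_pow (by omega) (Int.natAbs_ne_zero.2 hk) (ih hx').2 h6

/-- If `x ∉ ⟨⟨c⟩⟩` and the lift of `c` to the Cayley graph of `Γ` is an edge-simple closed path, then
some unipotent representation of the free group on the edges kills all lifts of `c`, but not that
of `x`. -/
theorem exists_unipotent_path_ne_one (hπ : Function.Surjective π) (hΓ : LocallyIndicable Γ)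
    {l : List (α × Bool)} (hl : π (FreeGroup.mk l) = 1)
    (hnd : ((pathList π 1 l).map Prod.fst).Nodup) {x : FreeGroup α} (hx : π x = 1)
    (hxl : x ∉ Subgroup.normalClosure {FreeGroup.mk l}) :
    ∃ (n : ℕ) (θ : Γ × α → (Matrix (Fin n) (Fin n) ℚ)ˣ),
      (∀ e, θ e ∈ (upperFiltration n).units 1) ∧
      (∀ g, FreeGroup.lift θ (path π g (FreeGroup.mk l)) = 1) ∧
      FreeGroup.lift θ (path π 1 x) ≠ 1 := by
  classical
  let t : Γ → FreeGroup α := Function.surjInv hπ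
  let R := Subgroup.normalClosure {FreeGroup.mk l}
  -- `ψ` kills the lifts of `y ∈ π.ker` exactly if `y ∈ R`
  let ψ : FreeGroup (Γ × α) →* FreeGroup α ⧸ R := (QuotientGroup.mk' R).comp (FreeGroup.lift
    fun e : Γ × α => t e.1 * FreeGroup.of e.2 * (t (e.1 * π (FreeGroup.of e.2)))⁻¹)
  have hψ : ∀ g y, π y = 1 → (ψ (path π g y) = 1 ↔ y ∈ R) := by
    intro g y hy
    rw [MonoidHom.comp_apply, lift_path, hy, mul_one, QuotientGroup.mk'_apply,
      QuotientGroup.eq_one_iff]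
    exact (Subgroup.normalClosure_normal.mem_comm_iff.trans (by simp [R]))
  have hcell : ∀ g, path π g (FreeGroup.mk l) =
      FreeGroup.map (shift g) (FreeGroup.mk (pathList π 1 l)) := by
    intro g
    rw [← path_mk, ← path_mul_left, mul_one]
  by_cases hne : l = []
  · subst hne
    obtain ⟨n, θ, hθ, h⟩ := exists_unipotent_ne_one (y := path π 1 x)
      (fun h => hxl ((hψ 1 x hx).1 (by rw [h, map_one])))
    exact ⟨n, θ, hθ, fun g => by simp [← FreeGroup.one_eq_mk], h⟩
  · -- on a saturated set `Z` of edges that contains those of `x`, the translates of `c` inside `Z` are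
    -- collapsed by `σ`; a representation that detects the image of `x` extends beyond `Z`
    obtain ⟨Z, hZ₀, hZ⟩ := exists_saturated hΓ (cls (FreeGroup.mk (pathList π 1 l)))
      ((path π 1 x).toWord.map Prod.fst).toFinset
    obtain ⟨e₀, he₀⟩ : ∃ e₀, e₀ ∈ (pathList π 1 l).map Prod.fst :=
      List.exists_mem_of_ne_nil _ fun h0 => hne (by
        have := congrArg List.length h0
        simpa using this)
    obtain ⟨σ, hσ, hσψ⟩ := exists_collapse hΓ hnd
      (fun h0 => by rw [h0] at he₀; simp at he₀) (Z.image fun z => z.1 * e₀.1⁻¹)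
    have hψσ := hσψ ψ fun g _ => by
      rw [← hcell]; exact (hψ g _ hl).2 (Subgroup.subset_normalClosure rfl)
    obtain ⟨n, θ₁, hθ₁, h₁⟩ := exists_unipotent_ne_one (y := FreeGroup.lift σ (path π 1 x))
      (fun h => hxl ((hψ 1 x hx).1 (by
        have := DFunLike.congr_fun hψσ (path π 1 x)
        rw [← this, MonoidHom.comp_apply, h, map_one])))
    have hcomp : ∀ y, FreeGroup.lift (fun e => FreeGroup.lift θ₁ (σ e)) y =
        FreeGroup.lift θ₁ (FreeGroup.lift σ y) := by
      intro y
      have : FreeGroup.lift (fun e => FreeGroup.lift θ₁ (σ e)) =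
          (FreeGroup.lift θ₁).comp (FreeGroup.lift σ) := by ext1 e; simp
      rw [this]; rfl
    obtain ⟨θ, hθ, hθZ, hθl⟩ := exists_extension (upperFiltration_term_self n) hnd hZ
      (θ₀ := fun e => FreeGroup.lift θ₁ (σ e))
      (fun e => FreeGroup.range_lift_le (by rintro _ ⟨e, rfl⟩; exact hθ₁ e) ⟨_, rfl⟩)
      (fun g hg => by
        rw [hcomp, hσ g, map_one]
        exact Finset.mem_image.2 ⟨shift g e₀, hg e₀ he₀, by simp [shift]⟩)
    refine ⟨n, θ, hθ, fun g => by rw [hcell, hθl], ?_⟩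
    have h2 : FreeGroup.lift θ (path π 1 x) = FreeGroup.lift θ₁ (FreeGroup.lift σ (path π 1 x)) := by
      rw [← hcomp, ← FreeGroup.mk_toWord (x := path π 1 x)]
      refine lift_mk_congr fun e he => hθZ e (hZ₀ ?_)
      exact List.mem_toFinset.2 he
    rwa [h2]

/-- A one-relator group whose relator lifts to an edge-simple closed path in the Cayley graph of
some rational derived quotient is residually rationally solvable. -/
theorem iInf_quotientSeries_le (hπ : Function.Surjective π) {l : List (α × Bool)} {n : ℕ}
    (hker : π.ker = quotientSeries (Subgroup.normalClosure {FreeGroup.mk l}) n)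
    (hΓ : LocallyIndicable Γ) (hnd : ((pathList π 1 l).map Prod.fst).Nodup) :
    ⨅ m, quotientSeries (Subgroup.normalClosure {FreeGroup.mk l}) m ≤
      Subgroup.normalClosure {FreeGroup.mk l} := by
  intro x hx
  by_contra hxl
  rw [Subgroup.mem_iInf] at hx
  have hker' : ∀ {y}, y ∈ quotientSeries (Subgroup.normalClosure {FreeGroup.mk l}) n → π y = 1 :=
    fun hy => by rwa [← MonoidHom.mem_ker, hker]
  obtain ⟨d, θ, hθ, hl, hx'⟩ := exists_unipotent_path_ne_one π hπ hΓ
    (hker' (le_quotientSeries _ n (Subgroup.subset_normalClosure rfl))) hnd (hker' (hx n)) hxl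
  have h1 := (Filtration.units_anti (Nat.le_succ d)
    (lift_path_mem_units π hker hθ hl d (hx (n + d))).2).1
  rw [upperFiltration_term_self, Submodule.mem_bot, sub_eq_zero] at h1
  exact hx' (Units.ext h1)

end Simple

/-! ### Circuits in the support of a closed path -/

section Circuit

variable {α Γ : Type*} [Group Γ] (π : FreeGroup α →* Γ)

/-- The initial vertex of an oriented edge. -/
def tail (d : (Γ × α) × Bool) : Γ := if d.2 then d.1.1 else d.1.1 * π (FreeGroup.of d.1.2)

/-- The terminal vertex of an oriented edge. -/
def head (d : (Γ × α) × Bool) : Γ := if d.2 then d.1.1 * π (FreeGroup.of d.1.2) else d.1.1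

theorem tail_head_getElem_pathList (g : Γ) (l : List (α × Bool)) (s : ℕ)
    (hs : s < (pathList π g l).length) :
    tail π (pathList π g l)[s] = g * π (FreeGroup.mk (l.take s)) ∧
      head π (pathList π g l)[s] = g * π (FreeGroup.mk (l.take (s + 1))) := by
  induction l generalizing g s with
  | nil => simp [pathList] at hs
  | cons x l ih =>
    obtain ⟨a, _ | _⟩ := x
    · cases s with
      | zero =>
        simp [pathList, tail, head, mk_cons_false, ← FreeGroup.one_eq_mk]
      | succ s =>
        simp only [pathList, List.length_cons, Nat.add_lt_add_iff_right] at hs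
        have := ih _ s hs
        simp only [pathList, List.getElem_cons_succ, List.take_succ_cons, mk_cons_false, map_mul,
          map_inv, ← mul_assoc]
        exact this
    · cases s with
      | zero =>
        simp [pathList, tail, head, mk_cons_true, ← FreeGroup.one_eq_mk]
      | succ s =>
        simp only [pathList, List.length_cons, Nat.add_lt_add_iff_right] at hs
        have := ih _ s hs
        simp only [pathList, List.getElem_cons_succ, List.take_succ_cons, mk_cons_true, map_mul,
          ← mul_assoc]
        exact this

theorem pathList_iterate {T : Type*} (S : T → T) (δ : T → (Γ × α) × Bool)
    (hS : ∀ t, tail π (δ (S t)) = head π (δ t)) (m : ℕ) (t : T) :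
    pathList π (tail π (δ t)) ((List.iterate S t m).map fun t => ((δ t).1.2, (δ t).2)) =
        (List.iterate S t m).map δ ∧
      tail π (δ t) * π (FreeGroup.mk ((List.iterate S t m).map fun t => ((δ t).1.2, (δ t).2))) =
        tail π (δ (S^[m] t)) := by
  induction m generalizing t with
  | zero => simp [pathList, ← FreeGroup.one_eq_mk]
  | succ m ih =>
    have h1 := ih (S t)
    rw [hS] at h1
    rw [List.iterate, List.map_cons, List.map_cons, Function.iterate_succ_apply]
    rcases hd : δ t with ⟨⟨g, a⟩, _ | _⟩
    · simp only [hd, head, tail, Bool.false_eq_true, if_false] at h1 ⊢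
      simp only [pathList, mk_cons_false, map_mul, map_inv, mul_inv_cancel_right, ← mul_assoc, h1]
      exact ⟨trivial, trivial⟩
    · simp only [hd, head, tail, if_true] at h1 ⊢
      simp only [pathList, mk_cons_true, map_mul, ← mul_assoc, h1]
      exact ⟨trivial, trivial⟩

/-- The boundary map of the Cayley graph. -/
noncomputable def boundary : (Γ × α →₀ ℚ) →ₗ[ℚ] Γ →₀ ℚ :=
  Finsupp.linearCombination ℚ fun e =>
    Finsupp.single (e.1 * π (FreeGroup.of e.2)) 1 - Finsupp.single e.1 1

theorem boundary_cls_path (g : Γ) (x : FreeGroup α) :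
    boundary π (cls (path π g x)) = Finsupp.single (g * π x) 1 - Finsupp.single g 1 := by
  induction x using FreeGroup.induction_on generalizing g with
  | C1 => simp
  | of a => simp [boundary]
  | inv_of a ih => rw [path_inv, cls_inv, map_neg, ih]; simp
  | mul x y hx hy => rw [path_mul, cls_mul, map_add, hx, hy]; simp [mul_assoc]

/-- The flow `f` is positive along the oriented edge `d`. -/
def PosOn (f : Γ × α →₀ ℚ) (d : (Γ × α) × Bool) : Prop := 0 < (if d.2 then 1 else -1) * f d.1

/-- At each vertex a flow without boundary leaves through some edge if it enters. -/
theorem exists_posOn_tail_eq_head {f : Γ × α →₀ ℚ} (hf : boundary π f = 0)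
    {d : (Γ × α) × Bool} (hd : PosOn f d) : ∃ d', PosOn f d' ∧ tail π d' = head π d := by
  classical
  by_contra! hall
  set v := head π d with hv
  have hsum := DFunLike.congr_fun hf v
  rw [boundary, Finsupp.linearCombination_apply, Finsupp.sum, Finsupp.finsetSum_apply,
    Finsupp.zero_apply] at hsum
  have hterm : ∀ e : Γ × α, (f e • (Finsupp.single (e.1 * π (FreeGroup.of e.2)) (1 : ℚ) -
      Finsupp.single e.1 1) : Γ →₀ ℚ) v =
        f e * ((if e.1 * π (FreeGroup.of e.2) = v then 1 else 0) - if e.1 = v then 1 else 0) := by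
    intro e
    rw [Finsupp.smul_apply, Finsupp.sub_apply, Finsupp.single_apply, Finsupp.single_apply,
      smul_eq_mul]
  have h1 : ∀ e : Γ × α, e.1 * π (FreeGroup.of e.2) = v → 0 ≤ f e := by
    intro e he
    by_contra hneg
    exact hall (e, false) (by simp only [PosOn, Bool.false_eq_true, if_false]; linarith)
      (by simpa [tail] using he)
  have h2 : ∀ e : Γ × α, e.1 = v → f e ≤ 0 := by
    intro e he
    by_contra hpos
    exact hall (e, true) (by simp only [PosOn, if_true]; linarith) (by simpa [tail] using he)
  have h3 := (Finset.sum_eq_zero_iff_of_nonneg (fun e _ => by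
    rw [hterm]
    by_cases ha : e.1 * π (FreeGroup.of e.2) = v <;> by_cases hb : e.1 = v
    · rw [if_pos ha, if_pos hb]; simp
    · rw [if_pos ha, if_neg hb]; simpa using h1 e ha
    · rw [if_neg ha, if_pos hb]; simpa using h2 e hb
    · rw [if_neg ha, if_neg hb]; simp)).1 hsum
  obtain ⟨e, _ | _⟩ := d
  · simp only [PosOn, Bool.false_eq_true, if_false] at hd
    simp only [head, Bool.false_eq_true, if_false] at hv
    have h4 := h3 e (Finsupp.mem_support_iff.2 (by intro h; simp [h] at hd))
    rw [hterm, if_pos hv.symm] at h4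
    by_cases ha : e.1 * π (FreeGroup.of e.2) = v
    · have := h1 e ha; linarith
    · rw [if_neg ha] at h4; linarith
  · simp only [PosOn, if_true] at hd
    simp only [head, if_true] at hv
    have h4 := h3 e (Finsupp.mem_support_iff.2 (by intro h; simp [h] at hd))
    rw [hterm, if_pos hv.symm] at h4
    by_cases ha : e.1 = v
    · have := h2 e ha; linarith
    · rw [if_neg ha] at h4; linarith

/-- A closed path `w` with nonzero class runs through an edge-simple circuit along which its class
is positive. A shortest segment of `w` leads to a vertex of the circuit: `w` has to travel to the
circuit, to use each of its edges, and to come back. -/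
theorem exists_circuit [DecidableEq α] {w : FreeGroup α} (hw : π w = 1)
    (h0 : cls (path π 1 w) ≠ 0) :
    ∃ (u : FreeGroup α) (l : List (α × Bool)), π (FreeGroup.mk l) = 1 ∧ l ≠ [] ∧
      ((pathList π (π u) l).map Prod.fst).Nodup ∧
      (∀ d ∈ pathList π (π u) l, PosOn (cls (path π 1 w)) d) ∧
      2 * u.norm + l.length ≤ w.norm := by
  classical
  set f := cls (path π 1 w) with hf
  have hbd : boundary π f = 0 := by rw [hf, boundary_cls_path, hw]; simp
  let T := {d : (Γ × α) × Bool // PosOn f d}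
  have hsupp : ∀ d : (Γ × α) × Bool, PosOn f d → d.1 ∈ f.support := by
    intro d hd
    rw [Finsupp.mem_support_iff]
    intro h
    rw [PosOn, h, mul_zero] at hd
    exact lt_irrefl _ hd
  have hfin : Finite T := by
    refine Finite.of_injective (β := f.support × Bool) (fun t => (⟨t.1.1, hsupp _ t.2⟩, t.1.2)) ?_
    intro t t' h
    simp only [Prod.mk.injEq, Subtype.mk.injEq] at h
    exact Subtype.ext (Prod.ext h.1 h.2)
  -- the positively traversed edges form a finite set `T`; each has a successor in `T`, and a periodic
  -- orbit of the successor map is a circuit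
  choose S hS using fun t : T => exists_posOn_tail_eq_head π hbd t.2
  let S' : T → T := fun t => ⟨S t, (hS t).1⟩
  obtain ⟨t₀, ht₀⟩ : ∃ t₀ : T, t₀ ∈ Function.periodicPts S' := by
    obtain ⟨e, he⟩ := Finsupp.support_nonempty_iff.2 h0
    rw [Finsupp.mem_support_iff] at he
    obtain ⟨t⟩ : Nonempty T := by
      rcases lt_or_gt_of_ne he with h | h
      · exact ⟨⟨(e, false), by simpa [PosOn] using h⟩⟩
      · exact ⟨⟨(e, true), by simpa [PosOn] using h⟩⟩
    obtain ⟨i, j, hij, h⟩ := Finite.exists_ne_map_eq_of_infinite fun n : ℕ => S'^[n] t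
    wlog hlt : i < j generalizing i j
    · exact this j i (Ne.symm hij) h.symm (by omega)
    refine ⟨S'^[i] t, j - i, by omega, ?_⟩
    rw [Function.IsPeriodicPt, Function.IsFixedPt, ← Function.iterate_add_apply,
      Nat.sub_add_cancel hlt.le, h]
  let V : Set Γ := {v | ∃ a : ℕ, tail π (S'^[a] t₀).1 = v}
  set L := w.toWord with hL
  have hwL : FreeGroup.mk L = w := FreeGroup.mk_toWord
  -- the edges of the orbit of `t₀` are traversed by `w` between two visits to `V`
  have hstep : ∀ a : ℕ, ∃ s, ∃ hs : s < (pathList π 1 L).length,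
      (pathList π 1 L)[s].1 = (S'^[a] t₀).1.1 ∧ π (FreeGroup.mk (L.take s)) ∈ V ∧
        π (FreeGroup.mk (L.take (s + 1))) ∈ V := by
    intro a
    set d := (S'^[a] t₀).1 with hd
    have h1 : d.1 ∈ (pathList π 1 L).map Prod.fst := by
      by_contra hmem
      refine Finsupp.mem_support_iff.1 (hsupp d (S'^[a] t₀).2) ?_
      rw [hf, ← hwL, path_mk]
      exact cls_mk_apply_of_notMem hmem
    obtain ⟨d', hd', hdd'⟩ := List.mem_map.1 h1
    obtain ⟨s, hs, hsd⟩ := List.getElem_of_mem hd'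
    have htail : tail π d ∈ V := ⟨a, rfl⟩
    have hhead : head π d ∈ V := ⟨a + 1, by
      rw [Function.iterate_succ_apply']
      exact (hS (S'^[a] t₀)).2⟩
    have h2 := tail_head_getElem_pathList π 1 L s hs
    rw [hsd, one_mul, one_mul] at h2
    refine ⟨s, hs, by rw [hsd, hdd'], ?_⟩
    rw [← h2.1, ← h2.2]
    by_cases hb : d'.2 = d.2
    · rw [Prod.ext hdd' hb]
      exact ⟨htail, hhead⟩
    · have h3 : tail π d' = head π d ∧ head π d' = tail π d := by
        obtain ⟨e', b'⟩ := d'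
        obtain ⟨e, b⟩ := d
        simp only at hdd' hb
        subst hdd'
        cases b <;> cases b' <;> simp_all [tail, head]
      rw [h3.1, h3.2]
      exact ⟨hhead, htail⟩
  have hex : ∃ s, π (FreeGroup.mk (L.take s)) ∈ V := by
    obtain ⟨s, -, -, h, -⟩ := hstep 0; exact ⟨s, h⟩
  -- the first and the last visit of `w` to the set `V` of the vertices of the circuit
  set i := Nat.find hex with hi
  set j := Nat.findGreatest (fun s => π (FreeGroup.mk (L.take s)) ∈ V) L.length with hj
  have hiV : π (FreeGroup.mk (L.take i)) ∈ V := Nat.find_spec hex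
  have hij : ∀ s < L.length, π (FreeGroup.mk (L.take s)) ∈ V →
      π (FreeGroup.mk (L.take (s + 1))) ∈ V → i ≤ s ∧ s < j := fun s hs h1 h2 =>
    ⟨Nat.find_min' hex h1, Nat.le_findGreatest (P := fun s => π (FreeGroup.mk (L.take s)) ∈ V)
      hs h2⟩
  have hjV : π (FreeGroup.mk (L.take j)) ∈ V := by
    obtain ⟨s, hs, -, -, h⟩ := hstep 0
    rw [length_pathList] at hs
    exact Nat.findGreatest_spec (P := fun s => π (FreeGroup.mk (L.take s)) ∈ V) hs h
  have hjL : j ≤ L.length := Nat.findGreatest_le _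
  have hiL : i ≤ j := by
    obtain ⟨s, hs, -, h1, h2⟩ := hstep 0
    rw [length_pathList] at hs
    have := hij s hs h1 h2
    omega
  obtain ⟨u, huV, hu⟩ : ∃ u : FreeGroup α, π u ∈ V ∧ 2 * u.norm + (j - i) ≤ L.length := by
    by_cases hle : i ≤ L.length - j
    · refine ⟨FreeGroup.mk (L.take i), hiV, ?_⟩
      have := FreeGroup.norm_mk_le (L₁ := L.take i)
      rw [List.length_take] at this
      omega
    · refine ⟨(FreeGroup.mk (L.drop j))⁻¹, ?_, ?_⟩
      · have h1 : FreeGroup.mk (L.take j) * FreeGroup.mk (L.drop j) = w := by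
          rw [FreeGroup.mul_mk, List.take_append_drop, hwL]
        have h2 : π (FreeGroup.mk (L.take j)) = π (FreeGroup.mk (L.drop j))⁻¹ := by
          rw [map_inv, ← mul_eq_one_iff_eq_inv, ← map_mul, h1, hw]
        rwa [← h2]
      · rw [FreeGroup.norm_inv_eq]
        have := FreeGroup.norm_mk_le (L₁ := L.drop j)
        rw [List.length_drop] at this
        omega
  obtain ⟨a, ha⟩ := huV
  set t := S'^[a] t₀ with ht
  have htper : t ∈ Function.periodicPts S' := by
    obtain ⟨n, hn, hper⟩ := ht₀
    exact ⟨n, hn, hper.apply_iterate a⟩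
  set m := Function.minimalPeriod S' t with hm
  have hm0 : 0 < m := Function.minimalPeriod_pos_of_mem_periodicPts htper
  obtain ⟨hl1, hl2⟩ := pathList_iterate π S' (fun t => t.1) (fun t => (hS t).2) m t
  rw [(Function.isPeriodicPt_minimalPeriod S' t : S'^[m] t = t), ha] at hl2
  rw [ha] at hl1
  -- an edge is not traversed in both directions, since the flow is positive along the orbit
  have hnd : ((((List.iterate S' t m).map fun t => t.1)).map Prod.fst).Nodup := by
    rw [List.map_map, ← List.range_map_iterate, List.map_map]
    refine List.nodup_range.map_on fun x hx y hy hxy => ?_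
    rw [List.mem_range] at hx hy
    refine Function.iterate_injOn_Iio_minimalPeriod hx hy (Subtype.ext (Prod.ext hxy ?_))
    have h1 := (S'^[x] t).2
    have h2 := (S'^[y] t).2
    simp only [Function.comp_apply] at hxy
    simp only [PosOn, hxy] at h1 h2
    by_contra hne
    cases hb : (S'^[x] t).1.2 <;> cases hb' : (S'^[y] t).1.2 <;> simp [hb, hb'] at h1 h2 hne
    · linarith
    · linarith
  refine ⟨u, (List.iterate S' t m).map fun t => (t.1.1.2, t.1.2), ?_, ?_, ?_, ?_, ?_⟩
  · simpa using hl2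
  · intro h
    have := congrArg List.length h
    rw [List.length_map, List.length_iterate] at this
    exact hm0.ne' this
  · rw [hl1]; exact hnd
  · rw [hl1]
    intro d hd
    obtain ⟨t', -, rfl⟩ := List.mem_map.1 hd
    exact t'.2
  · rw [List.length_map, List.length_iterate]
    suffices m ≤ j - i by
      have h1 : L.length = w.norm := rfl
      omega
    have hcard : ((((List.iterate S' t m).map fun t => t.1)).map Prod.fst).toFinset.card = m := by
      rw [List.toFinset_card_of_nodup hnd]; simp
    rw [← hcard, ← Finset.card_image_of_injective _ (Option.some_injective _), ← Nat.card_Ico]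
    refine (Finset.card_le_card (t := (Finset.Ico i j).image fun s =>
      ((pathList π 1 L)[s]?).map Prod.fst) ?_).trans Finset.card_image_le
    intro x hx
    obtain ⟨e, he, rfl⟩ := Finset.mem_image.1 hx
    rw [List.mem_toFinset, List.map_map, ← List.range_map_iterate, List.map_map] at he
    obtain ⟨b, -, rfl⟩ := List.mem_map.1 he
    obtain ⟨s, hs, h1, h2, h3⟩ := hstep (b + a)
    rw [length_pathList] at hs
    have h4 := hij s hs h2 h3
    refine Finset.mem_image.2 ⟨s, Finset.mem_Ico.2 h4, ?_⟩
    rw [List.getElem?_eq_getElem (by rwa [length_pathList]), Option.map_some, h1,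
      Function.iterate_add_apply]
    rfl

end Circuit

/-! ### The relator of the maximal residually rationally solvable quotient -/

section Omega

variable {G : Type*} [Group G]

/-- The preimage in `G` of the term of index `ω` of the rational derived series of `G ⧸ R`. -/
def quotientOmega (R : Subgroup G) [R.Normal] : Subgroup G := ⨅ n, quotientSeries R n

instance quotientOmega_normal (R : Subgroup G) [R.Normal] : (quotientOmega R).Normal :=
  Subgroup.normal_iInf_normal fun _ => inferInstance

theorem quotientOmega_eq_comap (R : Subgroup G) [R.Normal] :
    quotientOmega R = (rationalDerivedOmega (G ⧸ R)).comap (QuotientGroup.mk' R) := by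
  rw [rationalDerivedOmega, Subgroup.comap_iInf]; rfl

theorem le_quotientOmega (R : Subgroup G) [R.Normal] : R ≤ quotientOmega R :=
  le_iInf fun n => le_quotientSeries R n

theorem quotientOmega_le (R : Subgroup G) [R.Normal] (n : ℕ) :
    quotientOmega R ≤ quotientSeries R n := iInf_le _ n

/-- The rational derived series of `G ⧸ W` and `G ⧸ R` have the same preimages in `G` if `R` lies
between `W`, modulo commutators, and the term of index `ω`. -/
theorem quotientSeries_congr {W R : Subgroup G} [W.Normal] [R.Normal] (hR : R ≤ quotientOmega W)
    (hW : W ≤ ⁅quotientOmega W, quotientOmega W⁆ ⊔ R) (n : ℕ) :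
    quotientSeries W n = quotientSeries R n := by
  induction n with
  | zero => rw [quotientSeries_zero, quotientSeries_zero]
  | succ n ih =>
    ext x
    constructor
    · intro hx
      obtain ⟨h1, k, hk, h2⟩ := (mem_quotientSeries_succ W).1 hx
      refine (mem_quotientSeries_succ R).2 ⟨ih ▸ h1, k, hk, ?_⟩
      rw [← ih]
      refine sup_le le_sup_left (hW.trans (sup_le_sup_right ?_ R)) h2
      exact Subgroup.commutator_mono (quotientOmega_le W n) (quotientOmega_le W n)
    · intro hx
      obtain ⟨h1, k, hk, h2⟩ := (mem_quotientSeries_succ R).1 hx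
      rw [← ih] at h1 h2
      exact mem_quotientSeries_succ_of_zpow W h1 hk (sup_le
        (commutator_le_quotientSeries_succ W n) (hR.trans (quotientOmega_le W (n + 1))) h2)

theorem quotientOmega_congr {W R : Subgroup G} [W.Normal] [R.Normal] (hR : R ≤ quotientOmega W)
    (hW : W ≤ ⁅quotientOmega W, quotientOmega W⁆ ⊔ R) : quotientOmega W = quotientOmega R :=
  iInf_congr (quotientSeries_congr hR hW)

/-- The projection from the level `ω` to the level `n`. -/
def toLevel (W : Subgroup G) [W.Normal] (n : ℕ) : G ⧸ quotientOmega W →* G ⧸ quotientSeries W n :=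
  QuotientGroup.map _ _ (MonoidHom.id G) (quotientOmega_le W n)

/-- Finitely many elements of `G ⧸ quotientOmega W` remain distinct at some finite level. -/
theorem exists_injOn_map (W : Subgroup G) [W.Normal] (B : Finset (G ⧸ quotientOmega W)) :
    ∃ n, Set.InjOn (toLevel W n) (B : Set (G ⧸ quotientOmega W)) := by
  classical
  have hpair : ∀ p : (G ⧸ quotientOmega W) × (G ⧸ quotientOmega W), ∃ n₀, ∀ n ≥ n₀,
      toLevel W n p.1 = toLevel W n p.2 → p.1 = p.2 := by
    rintro ⟨g, h⟩
    induction g using QuotientGroup.induction_on with | _ x =>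
    induction h using QuotientGroup.induction_on with | _ y =>
    by_cases hxy : x⁻¹ * y ∈ quotientOmega W
    · exact ⟨0, fun _ _ _ => QuotientGroup.eq.2 hxy⟩
    · have hxy' := hxy
      rw [quotientOmega, Subgroup.mem_iInf, not_forall] at hxy'
      obtain ⟨n₀, hn₀⟩ := hxy'
      exact ⟨n₀, fun n hn h => absurd (quotientSeries_anti W hn (QuotientGroup.eq.1 h)) hn₀⟩
  choose N hN using hpair
  refine ⟨(B ×ˢ B).sup N, fun g hg h hh hgh => hN (g, h) _ ?_ hgh⟩
  exact Finset.le_sup (f := N) (Finset.mem_product.2 ⟨hg, hh⟩)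

end Omega

theorem exists_intCast_cls {X : Type*} (y : FreeGroup X) (e : X) : ∃ z : ℤ, cls y e = z := by
  classical
  induction y using FreeGroup.induction_on with
  | C1 => exact ⟨0, by simp⟩
  | of x => exact ⟨if x = e then 1 else 0, by rw [cls_of, Finsupp.single_apply]; split_ifs <;> simp⟩
  | inv_of x h => obtain ⟨z, hz⟩ := h; exact ⟨-z, by rw [cls_inv, Finsupp.neg_apply, hz]; simp⟩
  | mul x y hx hy =>
    obtain ⟨a, ha⟩ := hx
    obtain ⟨b, hb⟩ := hy
    exact ⟨a + b, by rw [cls_mul, Finsupp.add_apply, ha, hb]; simp⟩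

/-- Integral classes `f` and `h` that are proportional and have the same sign at a coefficient `±1`
of `h` satisfy `f = k • h` with `k ≥ 1`. -/
theorem exists_nat_smul_eq {X : Type*} {f h : X →₀ ℚ} {j : ℤ} {c : ℚ} (hj : j ≠ 0)
    (hjc : (j : ℚ) • h = c • f) {e : X} (hsq : h e * h e = 1) {z : ℤ} (hz : h e * f e = z)
    (hpos : 0 < h e * f e) : ∃ k : ℕ, 1 ≤ k ∧ f = k • h := by
  have hj' : (j : ℚ) ≠ 0 := Int.cast_ne_zero.2 hj
  have hE := DFunLike.congr_fun hjc e
  simp only [Finsupp.smul_apply, smul_eq_mul] at hE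
  have hzpos : 0 < z := by
    rw [hz] at hpos
    exact_mod_cast hpos
  have hjz : (j : ℚ) = c * z := by
    calc (j : ℚ) = j * h e * h e := by rw [mul_assoc, hsq, mul_one]
      _ = c * z := by rw [hE, ← hz]; ring
  have hc0 : c ≠ 0 := by rintro rfl; exact hj' (by rw [hjz, zero_mul])
  refine ⟨z.toNat, by omega, ?_⟩
  have h1 : c • f = c • ((z : ℚ) • h) := by
    rw [← hjc, hjz, mul_smul]
  have h3 : ((z.toNat : ℕ) : ℚ) = z := by
    have : ((z.toNat : ℕ) : ℤ) = z := Int.toNat_of_nonneg hzpos.le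
    exact_mod_cast this
  rw [← Nat.cast_smul_eq_nsmul ℚ, h3]
  exact smul_right_injective _ hc0 h1

theorem normalClosure_singleton_conj {G : Type*} [Group G] (u x : G) :
    Subgroup.normalClosure {u * x * u⁻¹} = Subgroup.normalClosure {x} := by
  have h : ∀ u x : G, Subgroup.normalClosure {u * x * u⁻¹} ≤ Subgroup.normalClosure {x} :=
    fun u x => Subgroup.normalClosure_le_normal (Set.singleton_subset_iff.2
      (Subgroup.normalClosure_normal.conj_mem _
        (Subgroup.subset_normalClosure (Set.mem_singleton x)) u))
  refine le_antisymm (h u x) ?_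
  have := h u⁻¹ (u * x * u⁻¹)
  simpa [mul_assoc] using this

section Relator

variable {α : Type*}

theorem path_zpow {Γ : Type*} [Group Γ] (π : FreeGroup α →* Γ) {x : FreeGroup α} (hx : π x = 1)
    (g : Γ) (k : ℤ) : path π g (x ^ k) = path π g x ^ k := by
  let f : π.ker →* FreeGroup (Γ × α) :=
    { toFun := fun z => path π g z
      map_one' := path_one π g
      map_mul' := fun y z => by
        rw [Subgroup.coe_mul, path_mul, MonoidHom.mem_ker.1 y.2, mul_one] }
  simpa [f] using map_zpow f ⟨x, hx⟩ k

/-- A projection that is injective on the edges of an edge-simple path maps it to an edge-simple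
path; and so are the translates of the latter. -/
theorem nodup_pathList_comp {Γ Γ' : Type*} [Group Γ] [Group Γ'] {π : FreeGroup α →* Γ} (q : Γ →* Γ')
    {g : Γ} {l : List (α × Bool)} (hnd : ((pathList π g l).map Prod.fst).Nodup)
    (hq : ∀ e ∈ (pathList π g l).map Prod.fst, ∀ e' ∈ (pathList π g l).map Prod.fst,
      q e.1 = q e'.1 → e.1 = e'.1) :
    ((pathList (q.comp π) 1 l).map Prod.fst).Nodup := by
  have h1 : ((pathList (q.comp π) (q g) l).map Prod.fst).Nodup := by
    rw [pathList_comp, List.map_map]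
    have h2 : (Prod.fst ∘ Prod.map (Prod.map q id) id : (Γ × α) × Bool → _) =
        Prod.map q id ∘ Prod.fst := rfl
    rw [h2, ← List.map_map]
    refine hnd.map_on fun e he e' he' hee' => ?_
    simp only [Prod.map, Prod.mk.injEq, id] at hee'
    exact Prod.ext (hq e he e' he' hee'.1) hee'.2
  have h3 := pathList_mul_left (q.comp π) (q g) 1 l
  rw [mul_one] at h3
  rw [h3, List.map_map] at h1
  have h4 : (Prod.fst ∘ Prod.map (shift (q g)) id : (Γ' × α) × Bool → _) =
      shift (q g) ∘ Prod.fst := rfl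
  rw [h4, ← List.map_map] at h1
  exact h1.of_map _

/-- Let `N` be the preimage of the term of index `ω` for the relator `w`. If the class of the
closed path `r` is supported on that of `w` in the Cayley graph of `FreeGroup α ⧸ N`, then they are
proportional. Indeed `r` dies rationally in `N ⧸ ⟨⟨w⟩⟩`, so at each finite level its class is a
multiple of that of `w`, by a group ring element which does not enlarge the support. -/
theorem exists_smul_cls_path_eq {w r : FreeGroup α}
    (hr : r ∈ quotientOmega (Subgroup.normalClosure {w}))
    (h0 : cls (path (QuotientGroup.mk' (quotientOmega (Subgroup.normalClosure {w}))) 1 w) ≠ 0)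
    (hsupp : (cls (path (QuotientGroup.mk' (quotientOmega (Subgroup.normalClosure {w}))) 1 r)).support
      ⊆ (cls (path (QuotientGroup.mk' (quotientOmega (Subgroup.normalClosure {w}))) 1 w)).support) :
    ∃ (j : ℤ) (c : ℚ), j ≠ 0 ∧
      (j : ℚ) • cls (path (QuotientGroup.mk' (quotientOmega (Subgroup.normalClosure {w}))) 1 r) =
        c • cls (path (QuotientGroup.mk' (quotientOmega (Subgroup.normalClosure {w}))) 1 w) := by
  classical
  set W := Subgroup.normalClosure {w} with hW
  set f := cls (path (QuotientGroup.mk' (quotientOmega W)) 1 w) with hf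
  set h := cls (path (QuotientGroup.mk' (quotientOmega W)) 1 r) with hh
  obtain ⟨n, hn⟩ := exists_injOn_map W (f.support.image Prod.fst)
  set q := toLevel W n with hq
  have hqπ : q.comp (QuotientGroup.mk' (quotientOmega W)) =
      QuotientGroup.mk' (quotientSeries W n) := rfl
  have hQ : Set.InjOn (Prod.map q (id : α → α)) (f.support : Set _) := by
    intro e he e' he' hee'
    simp only [Prod.map, Prod.mk.injEq, id] at hee'
    exact Prod.ext (hn (Finset.mem_coe.2 (Finset.mem_image_of_mem _ he))
      (Finset.mem_coe.2 (Finset.mem_image_of_mem _ he')) hee'.1) hee'.2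
  have hlevel : ∀ x, cls (path (QuotientGroup.mk' (quotientSeries W n)) 1 x) =
      (cls (path (QuotientGroup.mk' (quotientOmega W)) 1 x)).mapDomain (Prod.map q id) := by
    intro x
    rw [← cls_map, ← path_comp, hqπ, map_one]
  have hker : (QuotientGroup.mk' (quotientSeries W n)).ker = quotientSeries W n :=
    QuotientGroup.ker_mk' _
  have hrn := quotientOmega_le W n hr
  obtain ⟨-, j, hj, hrj⟩ := (mem_quotientSeries_succ W).1 (quotientOmega_le W (n + 1) hr)
  obtain ⟨p, hp⟩ := exists_cls_path_eq_conv (QuotientGroup.mk' (quotientSeries W n)) (w := w)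
    (x := r ^ j)
    (by rw [hker]; exact le_quotientSeries W n (Subgroup.subset_normalClosure rfl))
    (by rw [hker]; exact hrj)
  rw [path_zpow _ ((QuotientGroup.eq_one_iff r).2 hrn), cls_zpow, hlevel, hlevel, ← hf, ← hh,
    ← Int.cast_smul_eq_zsmul ℚ] at hp
  have hfn : (f.mapDomain (Prod.map q id)).support = f.support.image (Prod.map q id) :=
    Finsupp.mapDomain_support_of_injOn f hQ
  have hfn0 : f.mapDomain (Prod.map q id) ≠ 0 := by
    rw [← Finsupp.support_nonempty_iff, hfn]
    exact (Finsupp.support_nonempty_iff.2 h0).image _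
  have hpsupp := support_subset_one_of_conv (locallyIndicable_quotientSeries W n) p _ hfn0
    (fun e he => by
      rw [← hp, Finsupp.smul_apply] at he
      rw [hfn]
      exact Finset.image_subset_image hsupp (Finsupp.mapDomain_support
        (Finsupp.mem_support_iff.2 (right_ne_zero_of_mul he))))
  have hconv : conv p (f.mapDomain (Prod.map q id)) = p 1 • f.mapDomain (Prod.map q id) := by
    have hp1 : p = Finsupp.single 1 (p 1) := by
      ext g
      by_cases hg : g = 1
      · rw [hg, Finsupp.single_eq_same]
      · rw [Finsupp.single_eq_of_ne hg]
        by_contra hne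
        exact hg (hpsupp g (Finsupp.mem_support_iff.2 hne))
    ext e
    rw [hp1, conv, Finsupp.sum_single_index (by simp), Finsupp.single_eq_same, Finsupp.smul_apply,
      Finsupp.smul_apply, mapDomain_shift_apply]
    simp
  rw [hconv, ← Finsupp.mapDomain_smul, ← Finsupp.mapDomain_smul] at hp
  refine ⟨j, p 1, hj, Finsupp.mapDomain_injOn _ hQ ?_ ?_ hp⟩
  · exact fun e he => hsupp (Finsupp.support_smul he)
  · exact fun e he => Finsupp.support_smul he

/-- If `w` is a power of `r` modulo commutators of the preimage `N` of the term of index `ω` for the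
relator `w`, and if a conjugate of `r` is simple at a finite level, then `N` is the normal closure
of `r`. -/
theorem quotientOmega_eq_normalClosure {w r : FreeGroup α} {k : ℕ} {l : List (α × Bool)} {n : ℕ}
    (hrl : Subgroup.normalClosure {r} = Subgroup.normalClosure {FreeGroup.mk l})
    (hrN : r ∈ quotientOmega (Subgroup.normalClosure {w}))
    (hc : (r ^ k)⁻¹ * w ∈ ⁅quotientOmega (Subgroup.normalClosure {w}),
      quotientOmega (Subgroup.normalClosure {w})⁆)
    (hnd : ((pathList (QuotientGroup.mk' (quotientSeries (Subgroup.normalClosure {w}) n)) 1 l).map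
      Prod.fst).Nodup) :
    quotientOmega (Subgroup.normalClosure {w}) = Subgroup.normalClosure {r} ∧
      quotientOmega (Subgroup.normalClosure {r}) = Subgroup.normalClosure {r} := by
  have hR : Subgroup.normalClosure {FreeGroup.mk l} ≤ quotientOmega (Subgroup.normalClosure {w}) :=
    hrl ▸ Subgroup.normalClosure_le_normal (Set.singleton_subset_iff.2 hrN)
  have hr : r ∈ Subgroup.normalClosure {FreeGroup.mk l} :=
    hrl ▸ Subgroup.subset_normalClosure (Set.mem_singleton r)
  have hw : w ∈ ⁅quotientOmega (Subgroup.normalClosure {w}),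
      quotientOmega (Subgroup.normalClosure {w})⁆ ⊔ Subgroup.normalClosure {FreeGroup.mk l} := by
    have h1 := mul_mem (Subgroup.mem_sup_right (pow_mem hr k)) (Subgroup.mem_sup_left hc)
    rwa [mul_inv_cancel_left] at h1
  have hWR := Subgroup.normalClosure_le_normal (Set.singleton_subset_iff.2 hw)
  have hle := iInf_quotientSeries_le _ (QuotientGroup.mk'_surjective _)
    ((QuotientGroup.ker_mk' _).trans (quotientSeries_congr hR hWR n))
    (locallyIndicable_quotientSeries _ n) hnd
  have hom := quotientOmega_congr hR hWR
  have hRR : quotientOmega (Subgroup.normalClosure {FreeGroup.mk l}) =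
      Subgroup.normalClosure {FreeGroup.mk l} := le_antisymm hle (le_quotientOmega _)
  rw [hom, hRR]
  refine ⟨hrl.symm, ?_⟩
  simp only [hrl]
  exact hRR

/-- Each element `w` of a free group is a power of some `r` that is not longer than `w`, modulo
commutators of elements of the preimage `N` of the term of index `ω` for the relator `w`; moreover
`N` is the normal closure of `r`. -/
theorem exists_relator [DecidableEq α] (w : FreeGroup α) :
    ∃ (r : FreeGroup α) (k : ℕ), r.norm ≤ w.norm ∧ 1 ≤ k ∧
      quotientOmega (Subgroup.normalClosure {w}) = Subgroup.normalClosure {r} ∧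
      quotientOmega (Subgroup.normalClosure {r}) = Subgroup.normalClosure {r} ∧
      ∃ c ∈ ⁅Subgroup.normalClosure {r}, Subgroup.normalClosure {r}⁆, w = r ^ k * c := by
  classical
  set W := Subgroup.normalClosure {w} with hW
  have hwW : w ∈ W := Subgroup.subset_normalClosure rfl
  set N := quotientOmega W with hN
  set π := QuotientGroup.mk' N with hπ
  have hker : π.ker = N := QuotientGroup.ker_mk' _
  have hπ1 : ∀ {x}, π x = 1 ↔ x ∈ N := QuotientGroup.eq_one_iff _
  have hwN : w ∈ N := le_quotientOmega W hwW
  suffices ∃ (r : FreeGroup α) (k : ℕ) (l : List (α × Bool)) (n : ℕ), r.norm ≤ w.norm ∧ 1 ≤ k ∧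
      Subgroup.normalClosure {r} = Subgroup.normalClosure {FreeGroup.mk l} ∧ r ∈ N ∧
      (r ^ k)⁻¹ * w ∈ ⁅N, N⁆ ∧
      ((pathList (QuotientGroup.mk' (quotientSeries W n)) 1 l).map Prod.fst).Nodup by
    obtain ⟨r, k, l, n, hnorm, hk, hrl, hrN, hc, hnd⟩ := this
    obtain ⟨hNr, hRR⟩ := quotientOmega_eq_normalClosure hrl hrN hc hnd
    exact ⟨r, k, hnorm, hk, hNr, hRR, (r ^ k)⁻¹ * w, hNr ▸ hc, by rw [mul_inv_cancel_left]⟩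
  by_cases h0 : cls (path π 1 w) = 0
  · refine ⟨1, 1, [], 0, by simp, le_rfl, by rw [FreeGroup.one_eq_mk], one_mem N, ?_, by
      simp [pathList]⟩
    have := mem_commutator_of_cls_path_eq_zero π (QuotientGroup.mk'_surjective N)
      (by rw [hker]; exact hwN) h0
    rw [hker] at this
    simpa using this
  · obtain ⟨u, l, hl, hne, hnd, hpos, hlen⟩ := exists_circuit π (hπ1.2 hwN) h0
    set f := cls (path π 1 w) with hf
    set r := u * FreeGroup.mk l * u⁻¹ with hr
    have hlN : FreeGroup.mk l ∈ N := hπ1.1 hl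
    have hrN : r ∈ N := (inferInstance : N.Normal).conj_mem _ hlN u
    have hcls : cls (path π 1 r) = cls (FreeGroup.mk (pathList π (π u) l)) := by
      rw [hr, path_conj π u hl, cls_mul, cls_mul, cls_inv, one_mul, ← path_mk]
      abel
    have hsub : ∀ e ∈ (pathList π (π u) l).map Prod.fst, e ∈ f.support := by
      intro e he
      obtain ⟨d, hd, rfl⟩ := List.mem_map.1 he
      rw [Finsupp.mem_support_iff]
      intro h
      have := hpos d hd
      rw [PosOn, h, mul_zero] at this
      exact lt_irrefl _ this
    obtain ⟨j, c, hj, hjc⟩ := exists_smul_cls_path_eq (w := w) (r := r) hrN h0 (by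
      intro e he
      change e ∈ (cls (path π 1 r)).support at he
      rw [hcls, mem_support_cls_mk hnd] at he
      exact hsub e he)
    change (j : ℚ) • cls (path π 1 r) = c • f at hjc
    -- the factor is the value of the flow on an edge of the circuit
    obtain ⟨k, hk, hfk⟩ : ∃ k : ℕ, 1 ≤ k ∧ f = k • cls (path π 1 r) := by
      obtain ⟨d, hd⟩ : ∃ d, d ∈ pathList π (π u) l := List.exists_mem_of_ne_nil _ fun h => hne (by
        have := congrArg List.length h
        simpa using this)
      have hd1 : cls (path π 1 r) d.1 = if d.2 then 1 else -1 := by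
        rw [hcls]; exact cls_mk_apply_of_mem hnd hd
      have hdpos := hpos d hd
      rw [PosOn] at hdpos
      have hsq : cls (path π 1 r) d.1 * cls (path π 1 r) d.1 = 1 := by
        rw [hd1]; split_ifs <;> norm_num
      rw [← hd1] at hdpos
      obtain ⟨z, hz⟩ : ∃ z : ℤ, cls (path π 1 r) d.1 * f d.1 = z := by
        obtain ⟨a, ha⟩ := exists_intCast_cls (path π 1 r) d.1
        obtain ⟨b, hb⟩ := exists_intCast_cls (path π 1 w) d.1
        exact ⟨a * b, by rw [ha, hf, hb]; push_cast; rfl⟩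
      exact exists_nat_smul_eq hj hjc hsq hz hdpos
    obtain ⟨n, hn⟩ := exists_injOn_map W (f.support.image Prod.fst)
    refine ⟨r, k, l, n, ?_, hk, ?_, hrN, ?_, ?_⟩
    · have h1 := FreeGroup.norm_mul_le (u * FreeGroup.mk l) u⁻¹
      have h2 := FreeGroup.norm_mul_le u (FreeGroup.mk l)
      have h3 := FreeGroup.norm_mk_le (L₁ := l)
      rw [FreeGroup.norm_inv_eq, ← hr] at h1
      omega
    · exact normalClosure_singleton_conj u (FreeGroup.mk l)
    · have h1 := mem_commutator_of_cls_path_eq_zero π (QuotientGroup.mk'_surjective N)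
        (x := (r ^ k)⁻¹ * w)
        (by rw [hker]; exact mul_mem (inv_mem (pow_mem hrN k)) hwN)
        (by
          have h2 : π (r ^ k) = 1 := hπ1.2 (pow_mem hrN k)
          have h3 := path_zpow π (hπ1.2 hrN) 1 k
          rw [zpow_natCast, zpow_natCast] at h3
          rw [path_mul, path_inv, map_inv, h2, inv_one, mul_one, cls_mul, cls_inv, h3, cls_pow,
            ← hf, ← hfk, neg_add_cancel])
      rwa [hker] at h1
    · exact nodup_pathList_comp (toLevel W n) hnd fun e he e' he' hee' =>
        hn (Finset.mem_coe.2 (Finset.mem_image_of_mem _ (hsub e he)))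
          (Finset.mem_coe.2 (Finset.mem_image_of_mem _ (hsub e' he'))) hee'

end Relator

/-! ### Residually rationally solvable quotients -/

theorem map_rationalDerivedSeries_le {G H : Type*} [Group G] [Group H] (f : G →* H) (n : ℕ) :
    (rationalDerivedSeries G n).map f ≤ rationalDerivedSeries H n := by
  induction n with
  | zero => exact le_top
  | succ n ih =>
    rintro _ ⟨x, ⟨hx, k, hk, hxk⟩, rfl⟩
    refine ⟨ih (Subgroup.mem_map_of_mem f hx), k, hk, ?_⟩
    have h1 := Subgroup.mem_map_of_mem f hxk
    rw [Subgroup.map_commutator, map_zpow] at h1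
    exact Subgroup.commutator_mono ih ih h1

theorem map_rationalDerivedOmega_le {G H : Type*} [Group G] [Group H] (f : G →* H) :
    (rationalDerivedOmega G).map f ≤ rationalDerivedOmega H :=
  le_iInf fun n => (Subgroup.map_mono (iInf_le _ n)).trans (map_rationalDerivedSeries_le f n)

theorem isRationallyPerfect_of_eq {G : Type*} [Group G] {H : Subgroup G}
    (h : rationalDerivedSubgroup H = H) : IsRationallyPerfect H := by
  rw [IsRationallyPerfect, eq_top_iff]
  rintro ⟨x, hx⟩ -
  rw [← h] at hx
  obtain ⟨hxH, k, hk, hxk⟩ := hx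
  refine ⟨Subgroup.mem_top _, k, hk, ?_⟩
  have h1 : ⁅H, H⁆ = (⁅(⊤ : Subgroup H), (⊤ : Subgroup H)⁆).map H.subtype := by
    rw [Subgroup.map_commutator, ← MonoidHom.range_eq_map, Subgroup.range_subtype]
  rw [h1] at hxk
  obtain ⟨y, hy, hyx⟩ := hxk
  have h2 : y = (⟨x, hxH⟩ : H) ^ k := Subtype.ext (by simpa using hyx)
  rwa [← h2]

end OneRelator

open OneRelator in
theorem theorem1p1 {α : Type*} [DecidableEq α] (w : FreeGroup α) :
    ∃ (r : FreeGroup α) (k : ℕ),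
      r.norm ≤ w.norm ∧ 1 ≤ k ∧
      (∃ c ∈ ⁅Subgroup.normalClosure ({r} : Set (FreeGroup α)),
          Subgroup.normalClosure ({r} : Set (FreeGroup α))⁆, w = r ^ k * c) ∧
      RationalDerived.rationalDerivedOmegaSucc (RationalDerived.OneRelatorGroup w) =
        RationalDerived.rationalDerivedOmega (RationalDerived.OneRelatorGroup w) ∧
      RationalDerived.rationalDerivedOmega (RationalDerived.OneRelatorGroup w) =
        Subgroup.normalClosure {RationalDerived.OneRelatorGroup.proj w r} ∧
      RationalDerived.IsRationallyPerfect
        (RationalDerived.rationalDerivedOmega (RationalDerived.OneRelatorGroup w)) ∧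
      ∃ π : RationalDerived.OneRelatorGroup w →* RationalDerived.OneRelatorGroup r,
        π.comp (RationalDerived.OneRelatorGroup.proj w) =
            RationalDerived.OneRelatorGroup.proj r ∧
        RationalDerived.IsMaximalResiduallyRationallySolvableQuotient π := by
  obtain ⟨r, k, hnorm, hk, hN, hRR, c, hc, hw⟩ := exists_relator w
  have hsurj := QuotientGroup.mk'_surjective (Subgroup.normalClosure {w})
  have hrmem : r ∈ Subgroup.normalClosure {r} :=
    Subgroup.subset_normalClosure (Set.mem_singleton r)
  have hwr : w ∈ Subgroup.normalClosure {r} := by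
    rw [hw]
    exact mul_mem (pow_mem hrmem k) (Subgroup.commutator_le_left _ _ hc)
  have hmap : RationalDerived.rationalDerivedOmega (RationalDerived.OneRelatorGroup w) =
      (Subgroup.normalClosure {r}).map (RationalDerived.OneRelatorGroup.proj w) := by
    rw [← hN, quotientOmega_eq_comap, Subgroup.map_comap_eq_self_of_surjective hsurj]
  have hom : RationalDerived.rationalDerivedOmega (RationalDerived.OneRelatorGroup w) =
      Subgroup.normalClosure {RationalDerived.OneRelatorGroup.proj w r} := by
    rw [hmap, Subgroup.map_normalClosure _ _ hsurj, Set.image_singleton]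
  have hsucc : RationalDerived.rationalDerivedOmegaSucc (RationalDerived.OneRelatorGroup w) =
      RationalDerived.rationalDerivedOmega (RationalDerived.OneRelatorGroup w) := by
    refine le_antisymm (fun x hx => hx.1) ?_
    have hnormal : (RationalDerived.rationalDerivedOmegaSucc
        (RationalDerived.OneRelatorGroup w)).Normal :=
      rationalDerivedSubgroup_normal _
    have hmem : RationalDerived.OneRelatorGroup.proj w r ∈
        RationalDerived.rationalDerivedOmegaSucc (RationalDerived.OneRelatorGroup w) := by
      refine ⟨?_, k, by omega, ?_⟩
      · rw [hom]
        exact Subgroup.subset_normalClosure (Set.mem_singleton _)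
      · -- `r ^ k` is the inverse of `c` in the quotient by `w`
        rw [hmap, ← Subgroup.map_commutator, zpow_natCast, ← map_pow]
        refine ⟨c⁻¹, inv_mem hc, ?_⟩
        have h1 : RationalDerived.OneRelatorGroup.proj w w = 1 :=
          (QuotientGroup.eq_one_iff w).2 (Subgroup.subset_normalClosure (Set.mem_singleton w))
        rw [map_inv, inv_eq_iff_mul_eq_one, ← mul_eq_one_comm, ← map_mul, ← hw, h1]
    exact hom.le.trans (Subgroup.normalClosure_le_normal (Set.singleton_subset_iff.2 hmem))
  refine ⟨r, k, hnorm, hk, ⟨c, hc, hw⟩, hsucc, hom, isRationallyPerfect_of_eq hsucc, ?_⟩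
  let π : RationalDerived.OneRelatorGroup w →* RationalDerived.OneRelatorGroup r :=
    QuotientGroup.map _ _ (MonoidHom.id _)
      (Subgroup.normalClosure_le_normal (Set.singleton_subset_iff.2 hwr))
  have hπ : π.comp (RationalDerived.OneRelatorGroup.proj w) =
      RationalDerived.OneRelatorGroup.proj r := rfl
  have hπsurj : Function.Surjective π := by
    intro y
    obtain ⟨x, rfl⟩ := QuotientGroup.mk'_surjective _ y
    exact ⟨RationalDerived.OneRelatorGroup.proj w x, rfl⟩
  refine ⟨π, hπ, hπsurj, ?_, fun N _ hres => ?_⟩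
  · rw [RationalDerived.IsResiduallyRationallySolvable,
      ← Subgroup.map_comap_eq_self_of_surjective
        (QuotientGroup.mk'_surjective (Subgroup.normalClosure {r}))
        (RationalDerived.rationalDerivedOmega (RationalDerived.OneRelatorGroup r)),
      ← quotientOmega_eq_comap, hRR, QuotientGroup.map_mk'_self]
  · have hker : π.ker ≤ (QuotientGroup.mk' N).ker := by
      intro y hy
      obtain ⟨x, rfl⟩ := hsurj y
      have hx : x ∈ Subgroup.normalClosure {r} := (QuotientGroup.eq_one_iff x).1 hy
      have h1 : RationalDerived.OneRelatorGroup.proj w x ∈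
          RationalDerived.rationalDerivedOmega (RationalDerived.OneRelatorGroup w) := by
        rw [hmap]; exact Subgroup.mem_map_of_mem _ hx
      have h2 := map_rationalDerivedOmega_le (QuotientGroup.mk' N)
        (Subgroup.mem_map_of_mem _ h1)
      rw [show RationalDerived.rationalDerivedOmega
        (RationalDerived.OneRelatorGroup w ⧸ N) = ⊥ from hres] at h2
      exact Subgroup.mem_bot.1 h2
    exact ⟨π.liftOfSurjective hπsurj ⟨QuotientGroup.mk' N, hker⟩,
      MonoidHom.liftOfRightInverse_comp _ _ _ _⟩
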